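/- Let $\Sigma$ be an alphabet. Let $\mathsf{Syn}$ be the strict symmetric monoidal category (with composition $;$ in diagrammatic order, monoidal product $\oplus$, symmetries $\sigma$) freely generated by two objects $\blacktriangleright,\blacktriangleleft$ and the morphisms - black generators: $\Delta:\blacktriangleright\to\blacktriangleright^2$ (copy), $!:\blacktriangleright\to 0$ (delete), $\nabla:\blacktriangleright^2\to\blacktriangleright$ (merge), $?:0\to\blacktriangleright$ (generate); - $\eta:0\to\blacktriangleleft\blacktriangleright$ (cup) and $\varepsilon:\blacktriangleleft\blacktriangleright\to 0$ (cap), and $a:\blacktriangleright\to\blacktriangleright$ for each $a\in\Sigma$; - white generators: $\mu:\blacktriangleright^2\to\blacktriangleright$, $u:0\to\blacktriangleright$, $\delta:\blacktriangleright\to\blacktriangleright^2$, $v:\blacktriangleright\to 0$. Here $0$ is the monoidal unit and $\blacktriangleright^m$ is the $m$-fold product of $\blacktriangleright$. Morphisms of $\mathsf{Syn}$ are called diagrams. Write $1$ for the identity of $\blacktriangleright$, $1_{\blacktriangleleft}$ for the identity of $\blacktriangleleft$, $1_0$ for the empty diagram, $\sigma$ for the symmetry of $\blacktriangleright\blacktriangleright$,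 and $\chi=1\oplus\sigma\oplus 1$. Let $\leq_{KDA}$ be the smallest family of preorders on the hom-sets of $\mathsf{Syn}$ for which $;$ and $\oplus$ are monotone and which contains the following axioms, each equation standing for two inequalities: - (A) $(1\oplus\eta);((\sigma_{\blacktriangleright,\blacktriangleleft};\varepsilon)\oplus 1)=1$, $\;(\eta\oplus 1_{\blacktriangleleft});(1_{\blacktriangleleft}\oplus(\sigma_{\blacktriangleright,\blacktriangleleft};\varepsilon))=1_{\blacktriangleleft}$, $\;\eta;\varepsilon=1_0$. - (B) $(\Delta,!)$ is a cocommutative comonoid and $(\nabla,?)$ is a commutative monoid; $\nabla;\Delta=(\Delta\oplus\Delta);\chi;(\nabla\oplus\nabla)$, $\;?;\Delta=?\oplus ?$, $\;\nabla;!=!\oplus !$, $\;\Delta;\nabla=1$, $\;?;!=1_0$, $\;(\eta\oplus 1);(1_{\blacktriangleleft}\oplus(\nabla;\Delta));(\varepsilon\oplus 1)=1$. - (C) $(\delta,v)$ is a cocommutative comonoid and $(\mu,u)$ is a commutative monoid. - (D) $u;\Delta=u\oplus u$, $\;\mu;\Delta=(\Delta\oplus\Delta);\chi;(\mu\oplus\mu)$,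 $\;\mu;!=!\oplus !$, $\;?;\delta=?\oplus ?$, $\;\nabla;\delta=(\delta\oplus\delta);\chi;(\nabla\oplus\nabla)$, $\;\nabla;v=v\oplus v$. - (E) $(\nabla\oplus\nabla);\mu\leq\chi;(\mu\oplus\mu);\nabla$, $\;(?\oplus ?);\mu\leq ?$, $\;\delta;(\Delta\oplus\Delta)\leq\Delta;(\delta\oplus\delta);\chi$, $\;\delta;(!\oplus !)\leq !$; and for each $a\in\Sigma$: $a;\Delta=\Delta;(a\oplus a)$, $\;a;!=!$, $\;(a\oplus a);\mu=\mu;a$, $\;u=u;a$, $\;\nabla;a=(a\oplus a);\nabla$, $\;?;a=?$, $\;\delta;(a\oplus a)=a;\delta$, $\;v=a;v$. - (F) $\nabla;\Delta\leq 1\oplus 1$, $\;1\leq !;?$, $\;1\leq\Delta;\nabla$, $\;?;!\leq 1_0$, $\;1\oplus 1\leq\mu;\Delta$, $\;!;u\leq 1$, $\;\Delta;\mu\leq 1$, $\;1_0\leq u;!$, $\;1\oplus 1\leq\nabla;\delta$, $\;v;?\leq 1$, $\;\delta;\nabla\leq 1$, $\;1_0\leq ?;v$. Write $c=_{KDA}d$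 if $c\leq_{KDA}d$ and $d\leq_{KDA}c$. An automaton-diagram is a diagram built, using $;$, $\oplus$, identities and symmetries, from $\Delta,!,\nabla,?,\eta,\varepsilon$ and the letters $a\in\Sigma$ only. For $d:\blacktriangleright^m\to\blacktriangleright^n$, $1\le i\le m$ and $1\le j\le n$, the coefficient $d_{ij}:\blacktriangleright\to\blacktriangleright$ is the diagram obtained from $d$ by composing every input except the $i$-th one with $?$ and every output except the $j$-th one with $!$. **Corollary.** For all $m,n\ge 0$ and all automata-diagrams $d,e:\blacktriangleright^m\to\blacktriangleright^n$, we have $d=_{KDA}e$ if and only if $d_{ij}=_{KDA}e_{ij}$ for all $1\leq i\leq m$ and $1\leq j\leq n$. -/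

import Mathlib

namespace KDA

universe u

/-- The two generating objects: `right` is `▶` and `left` is `◀`. -/
inductive Dir : Type
  | right
  | left

/-- The generating morphisms over the alphabet `α`; the objects of the syntax are lists of
directions. `copy`, `del`, `merge`, `gen` are the black comultiplication, counit, multiplication
and unit on `▶`, `cup` and `cap` bend wires, `act a` is the action of the letter `a`, and `wmult`,
`wunit`, `wcomult`, `wcounit` are the white multiplication, unit, comultiplication and counit. -/
inductive Generator (α : Type u) : List Dir → List Dir → Type u
  | copy : Generator α [Dir.right] [Dir.right, Dir.right]
  | del : Generator α [Dir.right] []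
  | merge : Generator α [Dir.right, Dir.right] [Dir.right]
  | gen : Generator α [] [Dir.right]
  | cup : Generator α [] [Dir.left, Dir.right]
  | cap : Generator α [Dir.left, Dir.right] []
  | act (a : α) : Generator α [Dir.right] [Dir.right]
  | wmult : Generator α [Dir.right, Dir.right] [Dir.right]
  | wunit : Generator α [] [Dir.right]
  | wcomult : Generator α [Dir.right] [Dir.right, Dir.right]
  | wcounit : Generator α [Dir.right] []

/-- Terms for the morphisms of the free strict symmetric monoidal category. -/
inductive Term (α : Type u) : List Dir → List Dir → Type u
  | ofGen {A B : List Dir} (g : Generator α A B) : Term α A B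
  | id (A : List Dir) : Term α A A
  | comp {A B C : List Dir} (f : Term α A B) (g : Term α B C) : Term α A C
  | tensor {A B C D : List Dir} (f : Term α A B) (g : Term α C D) : Term α (A ++ C) (B ++ D)
  | swap (A B : List Dir) : Term α (A ++ B) (B ++ A)

/-- The identity of `A`, with codomain written as an equal list `B`. It is used only to compare
types such as `(A ++ B) ++ C` and `A ++ (B ++ C)`, which are equal lists. -/
def Term.idOfEq {α : Type u} {A B : List Dir} (h : A = B) : Term α A B :=
  match h with
  | rfl => Term.id A

/-- The laws of strict symmetric monoidal categories, closed under composition and monoidal product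
with a term on either side. The equivalence relation that it generates is the congruence of strict
symmetric monoidal categories. -/
inductive SMCLaw {α : Type u} : ∀ {A B : List Dir}, Term α A B → Term α A B → Prop
  | id_comp {A B : List Dir} (f : Term α A B) : SMCLaw ((Term.id A).comp f) f
  | comp_id {A B : List Dir} (f : Term α A B) : SMCLaw (f.comp (Term.id B)) f
  | assoc {A B C D : List Dir} (f : Term α A B) (g : Term α B C) (h : Term α C D) :
      SMCLaw ((f.comp g).comp h) (f.comp (g.comp h))
  | tensor_id (A B : List Dir) :
      SMCLaw ((Term.id A).tensor (Term.id B)) (Term.id (A ++ B))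
  | tensor_comp {A B C A' B' C' : List Dir} (f : Term α A B) (g : Term α B C)
      (f' : Term α A' B') (g' : Term α B' C') :
      SMCLaw ((f.comp g).tensor (f'.comp g')) ((f.tensor f').comp (g.tensor g'))
  | tensor_assoc {A B C A' B' C' : List Dir} (f : Term α A A') (g : Term α B B')
      (h : Term α C C') :
      SMCLaw (((f.tensor g).tensor h).comp (Term.idOfEq (List.append_assoc A' B' C')))
        ((Term.idOfEq (List.append_assoc A B C)).comp (f.tensor (g.tensor h)))
  | nil_tensor {A B : List Dir} (f : Term α A B) : SMCLaw ((Term.id []).tensor f) f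
  | tensor_nil {A B : List Dir} (f : Term α A B) :
      SMCLaw ((f.tensor (Term.id [])).comp (Term.idOfEq (List.append_nil B)))
        ((Term.idOfEq (List.append_nil A)).comp f)
  | swap_natural {A B C D : List Dir} (f : Term α A B) (g : Term α C D) :
      SMCLaw ((f.tensor g).comp (Term.swap B D)) ((Term.swap A C).comp (g.tensor f))
  | swap_swap (A B : List Dir) :
      SMCLaw ((Term.swap A B).comp (Term.swap B A)) (Term.id (A ++ B))
  | hexagon (A B C : List Dir) :
      SMCLaw ((Term.swap A (B ++ C)).comp (Term.idOfEq (List.append_assoc B C A)))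
        ((Term.idOfEq (List.append_assoc A B C).symm).comp
          (((Term.swap A B).tensor (Term.id C)).comp
            ((Term.idOfEq (List.append_assoc B A C)).comp
              ((Term.id B).tensor (Term.swap A C)))))
  | comp_left {A B C : List Dir} (f : Term α A B) {g g' : Term α B C} :
      SMCLaw g g' → SMCLaw (f.comp g) (f.comp g')
  | comp_right {A B C : List Dir} {f f' : Term α A B} (g : Term α B C) :
      SMCLaw f f' → SMCLaw (f.comp g) (f'.comp g)
  | tensor_left {A B C D : List Dir} (f : Term α A B) {g g' : Term α C D} :
      SMCLaw g g' → SMCLaw (f.tensor g) (f.tensor g')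
  | tensor_right {A B C D : List Dir} {f f' : Term α A B} (g : Term α C D) :
      SMCLaw f f' → SMCLaw (f.tensor g) (f'.tensor g)

/-- String diagrams: the morphisms `A → B` of the free strict symmetric monoidal category on the
generators. -/
def Diagram (α : Type u) (A B : List Dir) : Type u :=
  Quot (SMCLaw (α := α) (A := A) (B := B))

namespace Diagram

variable {α : Type u}

/-- The diagram consisting of a single generator. -/
def ofGen {A B : List Dir} (g : Generator α A B) : Diagram α A B := Quot.mk _ (Term.ofGen g)

/-- Parallel wires. -/
def id (A : List Dir) : Diagram α A A := Quot.mk _ (Term.id A)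

/-- Sequential composition, in diagrammatic order. -/
def comp {A B C : List Dir} (f : Diagram α A B) (g : Diagram α B C) : Diagram α A C :=
  Quot.map₂ Term.comp (fun f _ _ h => SMCLaw.comp_left f h)
    (fun _ _ g h => SMCLaw.comp_right g h) f g

/-- Monoidal product. -/
def tensor {A B C D : List Dir} (f : Diagram α A B) (g : Diagram α C D) :
    Diagram α (A ++ C) (B ++ D) :=
  Quot.map₂ Term.tensor (fun f _ _ h => SMCLaw.tensor_left f h)
    (fun _ _ g h => SMCLaw.tensor_right g h) f g

/-- The symmetry. -/
def swap (A B : List Dir) : Diagram α (A ++ B) (B ++ A) := Quot.mk _ (Term.swap A B)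

end Diagram

infixl:70 " ⨟ " => Diagram.comp
infixl:75 " ⊕ᵈ " => Diagram.tensor

namespace Diagram

variable {α : Type u}

def copy : Diagram α [Dir.right] [Dir.right, Dir.right] := ofGen Generator.copy
def del : Diagram α [Dir.right] [] := ofGen Generator.del
def merge : Diagram α [Dir.right, Dir.right] [Dir.right] := ofGen Generator.merge
def gen : Diagram α [] [Dir.right] := ofGen Generator.gen
def cup : Diagram α [] [Dir.left, Dir.right] := ofGen Generator.cup
def cap : Diagram α [Dir.left, Dir.right] [] := ofGen Generator.cap
def act (a : α) : Diagram α [Dir.right] [Dir.right] := ofGen (Generator.act a)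
def wmult : Diagram α [Dir.right, Dir.right] [Dir.right] := ofGen Generator.wmult
def wunit : Diagram α [] [Dir.right] := ofGen Generator.wunit
def wcomult : Diagram α [Dir.right] [Dir.right, Dir.right] := ofGen Generator.wcomult
def wcounit : Diagram α [Dir.right] [] := ofGen Generator.wcounit

/-- The empty diagram. -/
def empty : Diagram α [] [] := id []

/-- A single wire `▶`. -/
def wire : Diagram α [Dir.right] [Dir.right] := id [Dir.right]

/-- A single wire `◀`. -/
def coWire : Diagram α [Dir.left] [Dir.left] := id [Dir.left]

/-- Four parallel wires `▶`, the middle two of which cross. -/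
def cross : Diagram α [Dir.right, Dir.right, Dir.right, Dir.right]
    [Dir.right, Dir.right, Dir.right, Dir.right] :=
  wire ⊕ᵈ swap [Dir.right] [Dir.right] ⊕ᵈ wire

/-- The feedback loop that connects the top output to the top input. -/
def feedback (f : Diagram α [Dir.right, Dir.right] [Dir.right, Dir.right]) :
    Diagram α [Dir.right] [Dir.right] :=
  (cup ⊕ᵈ wire :) ⨟ (coWire ⊕ᵈ f :) ⨟ (cap ⊕ᵈ wire :)

end Diagram

open Diagram in
/-- The equational axioms of Kleene Diagram Algebra. -/
inductive EqAxiom {α : Type u} : ∀ {A B : List Dir}, Diagram α A B → Diagram α A B → Prop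
  -- compact closed structure, and elimination of loops
  | A1 : EqAxiom
      ((wire ⊕ᵈ cup :) ⨟ ((swap [Dir.right] [Dir.left] ⨟ cap :) ⊕ᵈ wire :)) wire
  | A2 : EqAxiom
      ((cup ⊕ᵈ coWire :) ⨟ (coWire ⊕ᵈ (swap [Dir.right] [Dir.left] ⨟ cap :) :)) coWire
  | A3 : EqAxiom (cup ⨟ cap) empty
  -- the black idempotent bimonoid
  | B1 : EqAxiom (copy ⨟ (copy ⊕ᵈ wire :)) (copy ⨟ (wire ⊕ᵈ copy :))
  | B2 : EqAxiom (copy ⨟ (wire ⊕ᵈ del :)) wire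
  | B3 : EqAxiom (copy ⨟ swap [Dir.right] [Dir.right]) copy
  | B4 : EqAxiom ((merge ⊕ᵈ wire :) ⨟ merge) ((wire ⊕ᵈ merge :) ⨟ merge)
  | B5 : EqAxiom ((wire ⊕ᵈ gen :) ⨟ merge) wire
  | B6 : EqAxiom (swap [Dir.right] [Dir.right] ⨟ merge) merge
  | B7 : EqAxiom (merge ⨟ copy) ((copy ⊕ᵈ copy :) ⨟ cross ⨟ (merge ⊕ᵈ merge :))
  | B8 : EqAxiom (gen ⨟ copy) (gen ⊕ᵈ gen :)
  | B9 : EqAxiom (merge ⨟ del) (del ⊕ᵈ del :)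
  | B10 : EqAxiom (copy ⨟ merge) wire
  | B11 : EqAxiom (gen ⨟ del) empty
  | B12 : EqAxiom (feedback (merge ⨟ copy)) wire
  -- the white comonoid and the white monoid
  | C1 : EqAxiom (wcomult ⨟ (wcomult ⊕ᵈ wire :)) (wcomult ⨟ (wire ⊕ᵈ wcomult :))
  | C2 : EqAxiom (wcomult ⨟ (wire ⊕ᵈ wcounit :)) wire
  | C3 : EqAxiom (wcomult ⨟ swap [Dir.right] [Dir.right]) wcomult
  | C4 : EqAxiom ((wmult ⊕ᵈ wire :) ⨟ wmult) ((wire ⊕ᵈ wmult :) ⨟ wmult)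
  | C5 : EqAxiom ((wire ⊕ᵈ wunit :) ⨟ wmult) wire
  | C6 : EqAxiom (swap [Dir.right] [Dir.right] ⨟ wmult) wmult
  -- the two bimonoids of mixed colours
  | D1 : EqAxiom (wunit ⨟ copy) (wunit ⊕ᵈ wunit :)
  | D2 : EqAxiom (wmult ⨟ copy) ((copy ⊕ᵈ copy :) ⨟ cross ⨟ (wmult ⊕ᵈ wmult :))
  | D3 : EqAxiom (wmult ⨟ del) (del ⊕ᵈ del :)
  | D4 : EqAxiom (gen ⨟ wcomult) (gen ⊕ᵈ gen :)
  | D5 : EqAxiom (merge ⨟ wcomult) ((wcomult ⊕ᵈ wcomult :) ⨟ cross ⨟ (merge ⊕ᵈ merge :))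
  | D6 : EqAxiom (merge ⨟ wcounit) (wcounit ⊕ᵈ wcounit :)
  -- the letters distribute over the other generators
  | E6 (a : α) : EqAxiom (act a ⨟ copy) (copy ⨟ (act a ⊕ᵈ act a :))
  | E7 (a : α) : EqAxiom (act a ⨟ del) del
  | E8 (a : α) : EqAxiom ((act a ⊕ᵈ act a :) ⨟ wmult) (wmult ⨟ act a)
  | E9 (a : α) : EqAxiom wunit (wunit ⨟ act a)
  | E10 (a : α) : EqAxiom (merge ⨟ act a) ((act a ⊕ᵈ act a :) ⨟ merge)
  | E11 (a : α) : EqAxiom (gen ⨟ act a) gen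
  | E12 (a : α) : EqAxiom (wcomult ⨟ (act a ⊕ᵈ act a :)) (act a ⨟ wcomult)
  | E13 (a : α) : EqAxiom wcounit (act a ⨟ wcounit)

open Diagram in
/-- The inequational axioms of Kleene Diagram Algebra: `LeAxiom c d` stands for `c ≤ d`. -/
inductive LeAxiom {α : Type u} : ∀ {A B : List Dir}, Diagram α A B → Diagram α A B → Prop
  -- lax distributivity of black over white
  | E1 : LeAxiom ((merge ⊕ᵈ merge :) ⨟ wmult) (cross ⨟ (wmult ⊕ᵈ wmult :) ⨟ merge)
  | E2 : LeAxiom ((gen ⊕ᵈ gen :) ⨟ wmult) gen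
  | E4 : LeAxiom (wcomult ⨟ (copy ⊕ᵈ copy :)) (copy ⨟ (wcomult ⊕ᵈ wcomult :) ⨟ cross)
  | E5 : LeAxiom (wcomult ⨟ (del ⊕ᵈ del :)) del
  -- the six adjunctions
  | F1 : LeAxiom (merge ⨟ copy) (wire ⊕ᵈ wire :)
  | F2 : LeAxiom wire (del ⨟ gen)
  | F3 : LeAxiom wire (copy ⨟ merge)
  | F4 : LeAxiom (gen ⨟ del) empty
  | F5 : LeAxiom (wire ⊕ᵈ wire :) (wmult ⨟ copy)
  | F6 : LeAxiom (del ⨟ wunit) wire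
  | F7 : LeAxiom (copy ⨟ wmult) wire
  | F8 : LeAxiom empty (wunit ⨟ del)
  | F9 : LeAxiom (wire ⊕ᵈ wire :) (merge ⨟ wcomult)
  | F10 : LeAxiom (wcounit ⨟ gen) wire
  | F11 : LeAxiom (wcomult ⨟ merge) wire
  | F12 : LeAxiom empty (gen ⨟ wcounit)

/-- The preorder of Kleene Diagram Algebra on diagrams of the same type: the smallest preorder that
contains the axioms (an equation counts as two inequalities) and for which sequential composition
and monoidal product are monotone. -/
inductive Le {α : Type u} : ∀ {A B : List Dir}, Diagram α A B → Diagram α A B → Prop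
  | of_eq {A B : List Dir} {c d : Diagram α A B} : EqAxiom c d → Le c d
  | of_eq_symm {A B : List Dir} {c d : Diagram α A B} : EqAxiom c d → Le d c
  | of_le {A B : List Dir} {c d : Diagram α A B} : LeAxiom c d → Le c d
  | refl {A B : List Dir} (c : Diagram α A B) : Le c c
  | trans {A B : List Dir} {c d e : Diagram α A B} : Le c d → Le d e → Le c e
  | comp {A B C : List Dir} {c c' : Diagram α A B} {d d' : Diagram α B C} :
      Le c c' → Le d d' → Le (c ⨟ d) (c' ⨟ d')
  | tensor {A B C D : List Dir} {c c' : Diagram α A B} {d d' : Diagram α C D} :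
      Le c c' → Le d d' → Le (c ⊕ᵈ d) (c' ⊕ᵈ d')

/-- Equality in Kleene Diagram Algebra. -/
def Equal {α : Type u} {A B : List Dir} (c d : Diagram α A B) : Prop := Le c d ∧ Le d c

open Diagram in
/-- Automata-diagrams: the diagrams built from the black generators, the letters, `cup` and
`cap`. -/
inductive IsAutomaton {α : Type u} : ∀ {A B : List Dir}, Diagram α A B → Prop
  | copy : IsAutomaton copy
  | del : IsAutomaton del
  | merge : IsAutomaton merge
  | gen : IsAutomaton gen
  | act (a : α) : IsAutomaton (act a)
  | cap : IsAutomaton cap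
  | cup : IsAutomaton cup
  | id (A : List Dir) : IsAutomaton (id A)
  | swap (A B : List Dir) : IsAutomaton (swap A B)
  | comp {A B C : List Dir} {c : Diagram α A B} {d : Diagram α B C} :
      IsAutomaton c → IsAutomaton d → IsAutomaton (c ⨟ d)
  | tensor {A B C D : List Dir} {c : Diagram α A B} {d : Diagram α C D} :
      IsAutomaton c → IsAutomaton d → IsAutomaton (c ⊕ᵈ d)

/-- The object `▶^m`. -/
abbrev rights (m : ℕ) : List Dir := List.replicate m Dir.right

namespace Diagram

variable {α : Type u}

/-- `m` parallel copies of `gen`. -/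
def genAll : (m : ℕ) → Diagram α [] (rights m)
  | 0 => empty
  | m + 1 => gen ⊕ᵈ genAll m

/-- `m` parallel copies of `del`. -/
def delAll : (m : ℕ) → Diagram α (rights m) []
  | 0 => empty
  | m + 1 => del ⊕ᵈ delAll m

/-- `m` parallel components: a wire in position `i` and `gen` in every other position. -/
def inject : (m : ℕ) → Fin m → Diagram α [Dir.right] (rights m)
  | 0, i => i.elim0
  | m + 1, ⟨0, _⟩ => wire ⊕ᵈ genAll m
  | m + 1, ⟨i + 1, h⟩ => gen ⊕ᵈ inject m ⟨i, Nat.lt_of_succ_lt_succ h⟩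

/-- `n` parallel components: a wire in position `j` and `del` in every other position. -/
def project : (n : ℕ) → Fin n → Diagram α (rights n) [Dir.right]
  | 0, j => j.elim0
  | n + 1, ⟨0, _⟩ => wire ⊕ᵈ delAll n
  | n + 1, ⟨j + 1, h⟩ => del ⊕ᵈ project n ⟨j, Nat.lt_of_succ_lt_succ h⟩

/-- The coefficient `d_ij : ▶ → ▶`, obtained by discarding every input except the `i`-th one with
`gen` and every output except the `j`-th one with `del`. -/
def coeff {m n : ℕ} (d : Diagram α (rights m) (rights n)) (i : Fin m) (j : Fin n) :
    Diagram α [Dir.right] [Dir.right] :=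
  inject m i ⨟ d ⨟ project n j

end Diagram

end KDA

/-! Modulo `Equal`, diagrams form a symmetric monoidal category whose hom-sets are partially
ordered. The heart of the proof is `IsAutomaton.isLinear`: an automaton-diagram `▶^m → ▶^n` commutes
exactly with the black operations ∇, ?, Δ, ! taken componentwise. For such linear morphisms `▶^n`
behaves like an `n`-fold biproduct. The identity of `▶^(m+1)` is the merge of the two embedded
factors, so a linear `d` is the merge of its restrictions to the first wire and to the others;
dually for copy and projections. With no inputs or no outputs, the unit and counit laws leave only
one linear morphism. Induction on `m` and then on `n` reduces `d` to its coefficients.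

Linearity cannot be checked generator by generator as an equation, because an automaton-diagram may
bend wires and pass through `◀`. There the multiplication is taken to be the mate of the
comultiplication of `▶`. Sliding mates along the wire shows that the cup respects the operations as
soon as `comul ≫ mul` compares with the identity, and the cap as soon as the identity compares with
`mul ≫ comul`. An adjunction gives exactly this, but only in one direction (`preserves_cup`,
`preserves_cap`).

Three adjunctions are therefore combined: μ ⊣ Δ, ∇ ⊣ δ and Δ ⊣ ∇, with their units and counits. The
third gives `∇;d ≤ (d⊕d);∇` and, by passing to adjoints, `d;Δ ≤ Δ;(d⊕d)`. The second gives the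
converse for ∇. The first gives `(d⊕d);μ ≤ μ;d`, whose adjoint form is the converse for Δ. The white
generators thus serve only to supply the opposite inequalities. -/

open CategoryTheory MonoidalCategory

namespace KDA

universe u

variable {α : Type u}

/-! ### Diagrams modulo equality in Kleene Diagram Algebra -/

/-- Diagrams are preordered by the relation of Kleene Diagram Algebra. -/
instance (A B : List Dir) : Preorder (Diagram α A B) where
  le := Le
  le_refl := Le.refl
  le_trans _ _ _ := Le.trans

theorem equal_comp {A B C : List Dir} {c c' : Diagram α A B} {d d' : Diagram α B C}
    (h : Equal c c') (k : Equal d d') : Equal (c ⨟ d) (c' ⨟ d') :=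
  ⟨Le.comp h.1 k.1, Le.comp h.2 k.2⟩

theorem equal_tensor {A B C D : List Dir} {c c' : Diagram α A B} {d d' : Diagram α C D}
    (h : Equal c c') (k : Equal d d') : Equal (c ⊕ᵈ d) (c' ⊕ᵈ d') :=
  ⟨Le.tensor h.1 k.1, Le.tensor h.2 k.2⟩

/-- Diagrams up to equality in Kleene Diagram Algebra. -/
abbrev Class (α : Type u) (A B : List Dir) : Type u :=
  Antisymmetrization (Diagram α A B) (· ≤ ·)

namespace Class

/-- The class of a diagram. -/
def mk {A B : List Dir} (d : Diagram α A B) : Class α A B := toAntisymmetrization (· ≤ ·) d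

theorem mk_le_mk {A B : List Dir} {d e : Diagram α A B} : mk d ≤ mk e ↔ Le d e := Iff.rfl

theorem mk_eq_mk {A B : List Dir} {d e : Diagram α A B} : mk d = mk e ↔ Equal d e :=
  ⟨fun h => Quotient.exact h, fun h => Quotient.sound h⟩

theorem sound {A B : List Dir} {f g : Term α A B} (h : SMCLaw f g) :
    mk (Quot.mk _ f) = mk (Quot.mk _ g) := by
  rw [Quot.sound h]

theorem eq_of_axiom {A B : List Dir} {c d : Diagram α A B} (h : EqAxiom c d) : mk c = mk d :=
  mk_eq_mk.2 ⟨.of_eq h, .of_eq_symm h⟩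

theorem le_of_axiom {A B : List Dir} {c d : Diagram α A B} (h : LeAxiom c d) : mk c ≤ mk d :=
  mk_le_mk.2 (.of_le h)

/-- Sequential composition of classes. -/
def comp {A B C : List Dir} (f : Class α A B) (g : Class α B C) : Class α A C :=
  Quotient.map₂ Diagram.comp (fun _ _ h _ _ k => equal_comp h k) f g

/-- Monoidal product of classes. -/
def tensor {A B C D : List Dir} (f : Class α A B) (g : Class α C D) :
    Class α (A ++ C) (B ++ D) :=
  Quotient.map₂ Diagram.tensor (fun _ _ h _ _ k => equal_tensor h k) f g

/-- The identity of `A`, with codomain written as an equal list. -/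
def idOfEq {A B : List Dir} (h : A = B) : Class α A B := mk (Quot.mk _ (Term.idOfEq h))

/-- The class of the symmetry. -/
def swap (A B : List Dir) : Class α (A ++ B) (B ++ A) := mk (Diagram.swap A B)

/-- Descends to terms rather than diagrams, since the laws of `SMCLaw` relate terms. -/
theorem ind {A B : List Dir} {p : Class α A B → Prop} (h : ∀ t, p (mk (Quot.mk _ t)))
    (f : Class α A B) : p f :=
  Quotient.ind (fun d => Quot.ind (β := fun d => p (mk d)) h d) f

theorem comp_mono {A B C : List Dir} {f f' : Class α A B} {g g' : Class α B C}
    (hf : f ≤ f') (hg : g ≤ g') : comp f g ≤ comp f' g' := by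
  induction f using Quotient.ind; induction f' using Quotient.ind
  induction g using Quotient.ind; induction g' using Quotient.ind
  exact Le.comp hf hg

theorem tensor_mono {A B C D : List Dir} {f f' : Class α A B} {g g' : Class α C D}
    (hf : f ≤ f') (hg : g ≤ g') : tensor f g ≤ tensor f' g' := by
  induction f using Quotient.ind; induction f' using Quotient.ind
  induction g using Quotient.ind; induction g' using Quotient.ind
  exact Le.tensor hf hg

theorem idOfEq_comp_idOfEq {A B C : List Dir} (h : A = B) (k : B = C) :
    comp (idOfEq (α := α) h) (idOfEq k) = idOfEq (h.trans k) := by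
  subst h k; exact sound (.id_comp _)

theorem idOfEq_tensor_idOfEq {A B C D : List Dir} (h : A = B) (k : C = D) :
    tensor (idOfEq (α := α) h) (idOfEq k) = idOfEq (congrArg₂ (· ++ ·) h k) := by
  subst h k; exact sound (.tensor_id _ _)

theorem id_tensor_idOfEq {A C D : List Dir} (k : C = D) :
    tensor (idOfEq (α := α) (rfl : A = A)) (idOfEq k) = idOfEq (congrArg (A ++ ·) k) :=
  idOfEq_tensor_idOfEq _ _

theorem idOfEq_tensor_id {A B C : List Dir} (h : A = B) :
    tensor (idOfEq (α := α) h) (idOfEq (rfl : C = C)) = idOfEq (congrArg (· ++ C) h) :=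
  idOfEq_tensor_idOfEq _ _

theorem id_comp {A B : List Dir} (f : Class α A B) : comp (idOfEq rfl) f = f := by
  induction f using ind; exact sound (.id_comp _)

theorem comp_id {A B : List Dir} (f : Class α A B) : comp f (idOfEq rfl) = f := by
  induction f using ind; exact sound (.comp_id _)

theorem assoc {A B C D : List Dir} (f : Class α A B) (g : Class α B C) (h : Class α C D) :
    comp (comp f g) h = comp f (comp g h) := by
  induction f using ind; induction g using ind; induction h using ind
  exact sound (.assoc _ _ _)

theorem tensor_comp {A B C A' B' C' : List Dir} (f : Class α A B) (g : Class α B C)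
    (f' : Class α A' B') (g' : Class α B' C') :
    comp (tensor f f') (tensor g g') = tensor (comp f g) (comp f' g') := by
  induction f using ind; induction g using ind; induction f' using ind; induction g' using ind
  exact (sound (.tensor_comp _ _ _ _)).symm

theorem tensor_assoc {A B C A' B' C' : List Dir} (f : Class α A A') (g : Class α B B')
    (h : Class α C C') :
    comp (tensor (tensor f g) h) (idOfEq (List.append_assoc A' B' C')) =
      comp (idOfEq (List.append_assoc A B C)) (tensor f (tensor g h)) := by
  induction f using ind; induction g using ind; induction h using ind
  exact sound (.tensor_assoc _ _ _)

theorem nil_tensor {A B : List Dir} (f : Class α A B) :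
    tensor (idOfEq (rfl : [] = [])) f = f := by
  induction f using ind; exact sound (.nil_tensor _)

theorem tensor_nil {A B : List Dir} (f : Class α A B) :
    comp (tensor f (idOfEq (rfl : [] = []))) (idOfEq (List.append_nil B)) =
      comp (idOfEq (List.append_nil A)) f := by
  induction f using ind; exact sound (.tensor_nil _)

theorem swap_natural {A B C D : List Dir} (f : Class α A B) (g : Class α C D) :
    comp (tensor f g) (swap B D) = comp (swap A C) (tensor g f) := by
  induction f using ind; induction g using ind; exact sound (.swap_natural _ _)

theorem swap_swap (A B : List Dir) :
    comp (swap (α := α) A B) (swap B A) = idOfEq rfl := sound (.swap_swap _ _)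

theorem hexagon (A B C : List Dir) :
    comp (swap (α := α) A (B ++ C)) (idOfEq (List.append_assoc B C A)) =
      comp (idOfEq (List.append_assoc A B C).symm)
        (comp (tensor (swap A B) (idOfEq rfl)) (comp (idOfEq (List.append_assoc B A C))
          (tensor (idOfEq rfl) (swap A C)))) := sound (.hexagon _ _ _)

/-- Every structural isomorphism is an `idOfEq`, and these are closed under composition and product;
coherence is then proof irrelevance for equalities of lists. -/
theorem pentagon (A B C D : List Dir) :
    comp (tensor (idOfEq (α := α) (List.append_assoc A B C)) (idOfEq (rfl : D = D)))
      (comp (idOfEq (List.append_assoc A (B ++ C) D))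
        (tensor (idOfEq (rfl : A = A)) (idOfEq (List.append_assoc B C D)))) =
      comp (idOfEq (List.append_assoc (A ++ B) C D)) (idOfEq (List.append_assoc A B (C ++ D))) := by
  rw [idOfEq_tensor_id, id_tensor_idOfEq, idOfEq_comp_idOfEq, idOfEq_comp_idOfEq,
    idOfEq_comp_idOfEq]

theorem triangle (A B : List Dir) :
    comp (idOfEq (α := α) (List.append_assoc A [] B))
      (tensor (idOfEq (rfl : A = A)) (idOfEq (List.nil_append B))) =
      tensor (idOfEq (List.append_nil A)) (idOfEq (rfl : B = B)) := by
  exact (congrArg _ (idOfEq_tensor_idOfEq _ _)).trans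
    ((idOfEq_comp_idOfEq _ _).trans (idOfEq_tensor_idOfEq _ _).symm)

end Class

/-! ### The symmetric monoidal category of diagram classes -/

/-- The objects of the category of diagrams up to equality in Kleene Diagram Algebra. -/
def Obj (_ : Type u) : Type := List Dir

instance : Category.{u} (Obj α) where
  Hom A B := Class α A B
  id _ := Class.idOfEq rfl
  comp := Class.comp
  id_comp := Class.id_comp
  comp_id := Class.comp_id
  assoc := Class.assoc

instance (A B : Obj α) : PartialOrder (A ⟶ B) :=
  inferInstanceAs (PartialOrder (Class α A B))

/-- The isomorphism between equal lists. -/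
def Obj.isoOfEq {A B : List Dir} (h : A = B) : Iso (C := Obj α) A B where
  hom := Class.idOfEq h
  inv := Class.idOfEq h.symm
  hom_inv_id := Class.idOfEq_comp_idOfEq _ _
  inv_hom_id := Class.idOfEq_comp_idOfEq _ _

instance : MonoidalCategoryStruct (Obj α) where
  tensorObj A B := List.append A B
  tensorHom := Class.tensor
  whiskerLeft A _ _ f := Class.tensor (Class.idOfEq (rfl : (A : List Dir) = A)) f
  whiskerRight f C := Class.tensor f (Class.idOfEq (rfl : (C : List Dir) = C))
  tensorUnit := ([] : List Dir)
  associator A B C := Obj.isoOfEq (List.append_assoc A B C)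
  leftUnitor A := Obj.isoOfEq (List.nil_append A)
  rightUnitor A := Obj.isoOfEq (List.append_nil A)

instance : MonoidalCategory (Obj α) := .ofTensorHom
  (id_tensorHom_id := fun _ _ => Class.idOfEq_tensor_idOfEq _ _)
  (id_tensorHom := fun _ _ _ _ => rfl)
  (tensorHom_id := fun _ _ => rfl)
  (tensorHom_comp_tensorHom := fun _ _ _ _ => Class.tensor_comp _ _ _ _)
  (associator_naturality := fun _ _ _ => Class.tensor_assoc _ _ _)
  (leftUnitor_naturality := fun f =>
    (Class.comp_id _).trans ((Class.nil_tensor f).trans (Class.id_comp f).symm))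
  (rightUnitor_naturality := fun f => Class.tensor_nil f)
  (pentagon := Class.pentagon)
  (triangle := Class.triangle)

/-- The symmetry as an isomorphism. -/
def Obj.braiding (A B : Obj α) : A ⊗ B ≅ B ⊗ A where
  hom := Class.swap A B
  inv := Class.swap B A
  hom_inv_id := Class.swap_swap A B
  inv_hom_id := Class.swap_swap B A

theorem Obj.hexagon (X Y Z : Obj α) :
    (α_ X Y Z).hom ≫ (Obj.braiding X (Y ⊗ Z)).hom ≫ (α_ Y Z X).hom =
      ((Obj.braiding X Y).hom ▷ Z) ≫ (α_ Y X Z).hom ≫ (Y ◁ (Obj.braiding X Z).hom) := by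
  rw [← Iso.eq_inv_comp]
  exact Class.hexagon X Y Z

instance : SymmetricCategory (Obj α) where
  braiding := Obj.braiding
  braiding_naturality_right X _ _ f := Class.swap_natural (Class.idOfEq rfl) f
  braiding_naturality_left f Z := Class.swap_natural f (Class.idOfEq rfl)
  hexagon_forward := Obj.hexagon
  hexagon_reverse X Y Z := by
    -- By symmetry, both sides of the reverse hexagon are inverse to the two sides of the forward
    -- hexagon for `Z`, `X`, `Y`; composing with the latter turns the goal into cancellations.
    rw [← cancel_epi ((α_ Z X Y).hom ≫ (Obj.braiding Z (X ⊗ Y)).hom ≫ (α_ X Y Z).hom)]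
    conv_rhs => rw [Obj.hexagon Z X Y]
    have e (A B : Obj α) : (Obj.braiding A B).hom ≫ (Obj.braiding B A).hom = 𝟙 _ :=
      Class.swap_swap A B
    have e' (A B : Obj α) {D : Obj α} (f : A ⊗ B ⟶ D) :
        (Obj.braiding A B).hom ≫ (Obj.braiding B A).hom ≫ f = f := by
      rw [← Category.assoc, e, Category.id_comp]
    simp only [Category.assoc, Iso.hom_inv_id_assoc, e', ← whiskerLeft_comp_assoc, e]
    simp [← comp_whiskerRight, e]
  symmetry A B := Class.swap_swap A B

/-! ### Exact pairings and mates -/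

section Monoidal

universe v w

variable {C : Type w} [Category.{v} C] [MonoidalCategory C]

/-- The left mate of a morphism for two chosen exact pairings. -/
def leftMate {X Y X' Y' : C} (p : ExactPairing X Y) (q : ExactPairing X' Y') (f : Y ⟶ Y') :
    X' ⟶ X :=
  @leftAdjointMate C _ _ Y Y' ⟨X⟩ ⟨X'⟩ f

theorem leftMate_comp_evaluation {X Y X' Y' : C} (p : ExactPairing X Y) (q : ExactPairing X' Y')
    (f : Y ⟶ Y') : Y ◁ leftMate p q f ≫ p.evaluation' = f ▷ X' ≫ q.evaluation' :=
  @leftAdjointMate_comp_evaluation C _ _ Y Y' ⟨X⟩ ⟨X'⟩ f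

theorem coevaluation_comp_leftMate {X Y X' Y' : C} (p : ExactPairing X Y) (q : ExactPairing X' Y')
    (f : Y ⟶ Y') : q.coevaluation' ≫ leftMate p q f ▷ Y' = p.coevaluation' ≫ X ◁ f :=
  @coevaluation_comp_leftAdjointMate C _ _ Y Y' ⟨X⟩ ⟨X'⟩ f

theorem cup_eq_leftMate_tensor {X Y : C} (p : ExactPairing X Y) (e : Y ⟶ 𝟙_ C) (i : 𝟙_ C ⟶ Y) :
    (λ_ (𝟙_ C)).inv ≫ (leftMate p exactPairingUnit e ⊗ₘ i) =
      p.coevaluation' ≫ X ◁ (e ≫ i) := by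
  have h : (ρ_ (𝟙_ C)).inv ≫ leftMate p exactPairingUnit e ▷ 𝟙_ C = p.coevaluation' ≫ X ◁ e :=
    coevaluation_comp_leftMate p exactPairingUnit e
  rw [MonoidalCategory.tensorHom_def, MonoidalCategory.whiskerLeft_comp, ← reassoc_of% h,
    unitors_inv_equal]

theorem associator_one {X Y Z : C} (i : 𝟙_ C ⟶ X) (j : 𝟙_ C ⟶ Y) (k : 𝟙_ C ⟶ Z) :
    (λ_ (𝟙_ C)).inv ≫ (((λ_ (𝟙_ C)).inv ≫ (i ⊗ₘ j)) ⊗ₘ k) ≫ (α_ X Y Z).hom =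
      (λ_ (𝟙_ C)).inv ≫ (i ⊗ₘ ((λ_ (𝟙_ C)).inv ≫ (j ⊗ₘ k))) := by
  have e : (λ_ (𝟙_ C)).inv ≫ (λ_ (𝟙_ C)).inv ▷ 𝟙_ C ≫ (α_ _ _ _).hom =
      (λ_ (𝟙_ C)).inv ≫ 𝟙_ C ◁ (λ_ (𝟙_ C)).inv := by monoidal
  have e₁ : ((λ_ (𝟙_ C)).inv ≫ (i ⊗ₘ j)) ⊗ₘ k = (λ_ (𝟙_ C)).inv ▷ 𝟙_ C ≫ ((i ⊗ₘ j) ⊗ₘ k) := by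
    rw [← tensorHom_id, tensorHom_comp_tensorHom, Category.id_comp]
  have e₂ : i ⊗ₘ ((λ_ (𝟙_ C)).inv ≫ (j ⊗ₘ k)) = 𝟙_ C ◁ (λ_ (𝟙_ C)).inv ≫ (i ⊗ₘ (j ⊗ₘ k)) := by
    rw [← id_tensorHom, tensorHom_comp_tensorHom, Category.id_comp]
  rw [e₁, e₂, Category.assoc, associator_naturality, reassoc_of% e]

variable [SymmetricCategory C]

theorem tensorμ_comp_braiding (X₁ X₂ Y₁ Y₂ : C) :
    tensorμ X₁ X₂ Y₁ Y₂ ≫ (β_ (X₁ ⊗ Y₁) (X₂ ⊗ Y₂)).hom =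
      ((β_ X₁ X₂).hom ⊗ₘ (β_ Y₁ Y₂).hom) ≫ tensorμ X₂ X₁ Y₂ Y₁ := by
  simp [tensorμ, SymmetricCategory.braiding_swap_eq_inv_braiding Y₁ X₂,
    MonoidalCategory.tensorHom_def]

open Functor.LaxMonoidal Functor.OplaxMonoidal in
/-- A monoidal functor preserves exact pairings. -/
@[reducible]
def mapExactPairing {D : Type*} [Category* D] [MonoidalCategory D] (F : D ⥤ C) [F.Monoidal]
    {X Y : D} (p : ExactPairing X Y) : ExactPairing (F.obj X) (F.obj Y) where
  coevaluation' := ε F ≫ F.map p.coevaluation' ≫ δ F X Y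
  evaluation' := μ F Y X ≫ F.map p.evaluation' ≫ η F
  coevaluation_evaluation' := by
    have h := congrArg (fun f => F.obj Y ◁ ε F ≫ μ F _ _ ≫ F.map f ≫ δ F _ _ ≫ η F ▷ F.obj Y)
      p.coevaluation_evaluation'
    simp only [Functor.map_comp, Functor.Monoidal.map_whiskerLeft,
      Functor.Monoidal.map_whiskerRight, Functor.Monoidal.map_associator_inv, Category.assoc,
      Functor.Monoidal.map_leftUnitor_inv, Functor.Monoidal.map_rightUnitor,
      Functor.Monoidal.μ_δ_assoc] at h
    simpa using h
  evaluation_coevaluation' := by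
    have h := congrArg (fun f => ε F ▷ F.obj X ≫ μ F _ _ ≫ F.map f ≫ δ F _ _ ≫ F.obj X ◁ η F)
      p.evaluation_coevaluation'
    simp only [Functor.map_comp, Functor.Monoidal.map_whiskerLeft,
      Functor.Monoidal.map_whiskerRight, Functor.Monoidal.map_associator, Category.assoc,
      Functor.Monoidal.map_rightUnitor_inv, Functor.Monoidal.map_leftUnitor,
      Functor.Monoidal.μ_δ_assoc] at h
    simpa using h

/-- The pairing of a product with itself. -/
@[reducible]
def squarePairing {X Y : C} (p : ExactPairing X Y) : ExactPairing (X ⊗ X) (Y ⊗ Y) :=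
  mapExactPairing (tensor C) (X := (X, X)) (Y := (Y, Y))
    { coevaluation' := (p.coevaluation', p.coevaluation')
      evaluation' := (p.evaluation', p.evaluation')
      coevaluation_evaluation' :=
        Prod.ext p.coevaluation_evaluation' p.coevaluation_evaluation'
      evaluation_coevaluation' :=
        Prod.ext p.evaluation_coevaluation' p.evaluation_coevaluation' }

/-- The two cups stand side by side and are then crossed, not nested. Hence the mate of `Y ⟶ Y ⊗ Y`
is a multiplication on `X` whose two factors keep their order. -/
theorem squarePairing_coevaluation {X Y : C} (p : ExactPairing X Y) :
    (squarePairing p).coevaluation' =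
      (λ_ (𝟙_ C)).inv ≫ (p.coevaluation' ⊗ₘ p.coevaluation') ≫ tensorδ X X Y Y := rfl

theorem squarePairing_evaluation {X Y : C} (p : ExactPairing X Y) :
    (squarePairing p).evaluation' =
      tensorμ Y Y X X ≫ (p.evaluation' ⊗ₘ p.evaluation') ≫ (λ_ (𝟙_ C)).hom := rfl

theorem tensorδ_eq_tensorμ (X₁ X₂ Y₁ Y₂ : C) : tensorδ X₁ X₂ Y₁ Y₂ = tensorμ X₁ Y₁ X₂ Y₂ := by
  simp [tensorδ, tensorμ, SymmetricCategory.braiding_swap_eq_inv_braiding X₂ Y₁]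

theorem tensorμ_tensorμ (X₁ X₂ Y₁ Y₂ : C) :
    tensorμ X₁ X₂ Y₁ Y₂ ≫ tensorμ X₁ Y₁ X₂ Y₂ = 𝟙 _ := by
  rw [← tensorδ_eq_tensorμ X₁ X₂, tensorμ_tensorδ]

/-- Sliding the mate along the cup turns it back into `c` on the `Y` strand, where it meets `m`. -/
theorem cup_comp_leftMate_tensor {X Y : C} (p : ExactPairing X Y) (c : Y ⟶ Y ⊗ Y) (m : Y ⊗ Y ⟶ Y) :
    (p.coevaluation' ⊗ₘ p.coevaluation') ≫ tensorμ X Y X Y ≫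
        (leftMate p (squarePairing p) c ⊗ₘ m) =
      (λ_ (𝟙_ C)).hom ≫ p.coevaluation' ≫ X ◁ (c ≫ m) := by
  have h := coevaluation_comp_leftMate p (squarePairing p) c
  rw [squarePairing_coevaluation, tensorδ_eq_tensorμ, Category.assoc, Iso.inv_comp_eq,
    Category.assoc] at h
  rw [MonoidalCategory.tensorHom_def (leftMate p (squarePairing p) c) m, reassoc_of% h]
  simp

/-- The counterpart for the cap: the mate slides across and becomes `c`, now applied after `m`. The
remaining work is to move the braiding past the middle exchange. -/
theorem leftMate_tensor_comp_cap {X Y : C} (p : ExactPairing X Y) (c : Y ⟶ Y ⊗ Y)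
    (m : Y ⊗ Y ⟶ Y) :
    (leftMate p (squarePairing p) c ⊗ₘ m) ≫ (β_ X Y).hom ≫ p.evaluation' =
      (X ⊗ X) ◁ (m ≫ c) ≫ tensorμ X X Y Y ≫
        (((β_ X Y).hom ≫ p.evaluation') ⊗ₘ ((β_ X Y).hom ≫ p.evaluation')) ≫
          (λ_ (𝟙_ C)).hom := by
  have h := leftMate_comp_evaluation p (squarePairing p) c
  rw [squarePairing_evaluation] at h
  have e := tensorμ_comp_braiding X Y X Y
  rw [reassoc_of% BraidedCategory.braiding_naturality,
    MonoidalCategory.tensorHom_def m, Category.assoc, h, ← comp_whiskerRight_assoc,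
    ← BraidedCategory.braiding_naturality_right_assoc, ← tensorHom_comp_tensorHom_assoc,
    ← Category.id_comp (β_ (X ⊗ X) (Y ⊗ Y)).hom, ← tensorμ_tensorμ X X Y Y, Category.assoc,
    Category.assoc, reassoc_of% e, reassoc_of% tensorμ_tensorμ Y X Y X]

theorem leftMate_tensor_comp_cap_unit {X Y : C} (p : ExactPairing X Y) (e : Y ⟶ 𝟙_ C)
    (i : 𝟙_ C ⟶ Y) :
    (λ_ (𝟙_ C)).inv ≫ (leftMate p exactPairingUnit e ⊗ₘ i) ≫ (β_ X Y).hom ≫ p.evaluation' =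
      i ≫ e := by
  have h : Y ◁ leftMate p exactPairingUnit e ≫ p.evaluation' = e ▷ 𝟙_ C ≫ (ρ_ (𝟙_ C)).hom :=
    leftMate_comp_evaluation p exactPairingUnit e
  rw [reassoc_of% BraidedCategory.braiding_naturality,
    MonoidalCategory.tensorHom_def i, Category.assoc, h]
  simp [← unitors_equal, ← unitors_inv_equal]

/-! ### Componentwise operations on products -/

/-- The multiplication on a product of two objects with multiplications. -/
abbrev tensorMul {X Y : C} (m : X ⊗ X ⟶ X) (n : Y ⊗ Y ⟶ Y) : (X ⊗ Y) ⊗ X ⊗ Y ⟶ X ⊗ Y :=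
  tensorμ X Y X Y ≫ (m ⊗ₘ n)

theorem associator_tensorMul {X Y Z : C} (m : X ⊗ X ⟶ X) (n : Y ⊗ Y ⟶ Y) (p : Z ⊗ Z ⟶ Z) :
    tensorMul (tensorMul m n) p ≫ (α_ X Y Z).hom =
      ((α_ X Y Z).hom ⊗ₘ (α_ X Y Z).hom) ≫ tensorMul m (tensorMul n p) := by
  have h := associator_monoidal X Y Z X Y Z
  have e : ((X ⊗ X) ◁ tensorμ Y Z Y Z) ≫ (m ⊗ₘ n ⊗ₘ p) = m ⊗ₘ (tensorμ Y Z Y Z ≫ (n ⊗ₘ p)) := by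
    simp [← id_tensorHom]
  have e' : (tensorμ X Y X Y ▷ (Z ⊗ Z)) ≫ ((m ⊗ₘ n) ⊗ₘ p) =
      (tensorμ X Y X Y ≫ (m ⊗ₘ n)) ⊗ₘ p := by
    rw [← tensorHom_id, tensorHom_comp_tensorHom, Category.id_comp]
  simp only [tensorMul]
  rw [← e, ← e', ← reassoc_of% h]
  simp only [Category.assoc, associator_naturality]

theorem braiding_one {X Y : C} (i : 𝟙_ C ⟶ X) (j : 𝟙_ C ⟶ Y) :
    (λ_ (𝟙_ C)).inv ≫ (i ⊗ₘ j) ≫ (β_ X Y).hom = (λ_ (𝟙_ C)).inv ≫ (j ⊗ₘ i) := by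
  rw [BraidedCategory.braiding_naturality]
  simp [unitors_inv_equal]

theorem braiding_tensorMul {X Y : C} (m : X ⊗ X ⟶ X) (n : Y ⊗ Y ⟶ Y) :
    ((β_ X Y).hom ⊗ₘ (β_ X Y).hom) ≫ tensorMul n m = tensorMul m n ≫ (β_ X Y).hom := by
  have h := tensorμ_comp_braiding X Y X Y
  simp only [tensorMul]
  rw [← reassoc_of% h, Category.assoc, BraidedCategory.braiding_naturality]

theorem leftUnitor_tensorMul {X : C} (m : X ⊗ X ⟶ X) :
    tensorMul (λ_ (𝟙_ C)).hom m ≫ (λ_ X).hom = ((λ_ X).hom ⊗ₘ (λ_ X).hom) ≫ m := by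
  rw [leftUnitor_monoidal]
  simp [MonoidalCategory.tensorHom_def]

theorem rightUnitor_tensorMul {X : C} (m : X ⊗ X ⟶ X) :
    tensorMul m (λ_ (𝟙_ C)).hom ≫ (ρ_ X).hom = ((ρ_ X).hom ⊗ₘ (ρ_ X).hom) ≫ m := by
  rw [rightUnitor_monoidal]
  simp [MonoidalCategory.tensorHom_def']

theorem tensorμ_unit (X Y : C) :
    ((ρ_ X).inv ⊗ₘ (λ_ Y).inv) ≫ tensorμ X (𝟙_ C) (𝟙_ C) Y ≫ ((ρ_ X).hom ⊗ₘ (λ_ Y).hom) = 𝟙 _ := by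
  simp only [tensorμ, braiding_tensorUnit_left, MonoidalCategory.tensorHom_def]
  monoidal

/-- Each inclusion fills the other factor with a unit, which the componentwise multiplication
absorbs. This is the half of the biproduct structure that recovers a morphism from its restrictions.
-/
theorem tensor_inclusions_comp_tensorMul {X Y : C} {m : X ⊗ X ⟶ X} {i : 𝟙_ C ⟶ X} {n : Y ⊗ Y ⟶ Y}
    {j : 𝟙_ C ⟶ Y} (hm : X ◁ i ≫ m = (ρ_ X).hom) (hn : j ▷ Y ≫ n = (λ_ Y).hom) :
    (((ρ_ X).inv ≫ X ◁ j) ⊗ₘ ((λ_ Y).inv ≫ i ▷ Y)) ≫ tensorMul m n = 𝟙 _ := by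
  simp only [tensorMul]
  rw [← tensorHom_comp_tensorHom, ← id_tensorHom, ← tensorHom_id, Category.assoc,
    reassoc_of% tensorμ_natural, tensorHom_comp_tensorHom, id_tensorHom, tensorHom_id, hm, hn,
    tensorμ_unit]

theorem tensorComul_comp_tensor_projections {X Y : C} {c : X ⟶ X ⊗ X} {e : X ⟶ 𝟙_ C}
    {d : Y ⟶ Y ⊗ Y} {f : Y ⟶ 𝟙_ C} (hc : c ≫ X ◁ e = (ρ_ X).inv) (hd : d ≫ f ▷ Y = (λ_ Y).inv) :
    ((c ⊗ₘ d) ≫ tensorμ X X Y Y) ≫ ((X ◁ f ≫ (ρ_ X).hom) ⊗ₘ (e ▷ Y ≫ (λ_ Y).hom)) = 𝟙 _ := by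
  rw [← tensorHom_comp_tensorHom, ← id_tensorHom, ← tensorHom_id, Category.assoc,
    ← tensorμ_natural_assoc, tensorHom_comp_tensorHom_assoc, id_tensorHom, tensorHom_id, hc, hd,
    tensorμ_unit]

theorem tensorComul_comp_tensorMul {X Y X' Y' : C} (c : X' ⟶ X ⊗ X) (d : Y' ⟶ Y ⊗ Y)
    (m : X ⊗ X ⟶ X) (n : Y ⊗ Y ⟶ Y) :
    ((c ⊗ₘ d) ≫ tensorμ X X Y Y) ≫ tensorMul m n = (c ≫ m) ⊗ₘ (d ≫ n) := by
  rw [Category.assoc, reassoc_of% tensorμ_tensorμ X X Y Y, tensorHom_comp_tensorHom]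

theorem tensorMul_comp_tensorComul {X Y : C} (m : X ⊗ X ⟶ X) (n : Y ⊗ Y ⟶ Y) (c : X ⟶ X ⊗ X)
    (d : Y ⟶ Y ⊗ Y) :
    tensorMul m n ≫ ((c ⊗ₘ d) ≫ tensorμ X X Y Y) =
      tensorμ X Y X Y ≫ ((m ≫ c) ⊗ₘ (n ≫ d)) ≫ tensorμ X X Y Y := by
  rw [Category.assoc, tensorHom_comp_tensorHom_assoc]

theorem tensorMul_one {X Y : C} {m : X ⊗ X ⟶ X} {i : 𝟙_ C ⟶ X} {n : Y ⊗ Y ⟶ Y}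
    {j : 𝟙_ C ⟶ Y} (hm : i ▷ X ≫ m = (λ_ X).hom) (hn : j ▷ Y ≫ n = (λ_ Y).hom) :
    ((λ_ (𝟙_ C)).inv ≫ (i ⊗ₘ j)) ▷ (X ⊗ Y) ≫ tensorMul m n = (λ_ (X ⊗ Y)).hom := by
  rw [comp_whiskerRight, Category.assoc, tensorμ_natural_left_assoc, tensorHom_comp_tensorHom, hm,
    hn, ← tensor_left_unitality]

theorem tensorComul_counit {X Y : C} {c : X ⟶ X ⊗ X} {e : X ⟶ 𝟙_ C} {d : Y ⟶ Y ⊗ Y}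
    {f : Y ⟶ 𝟙_ C} (hc : c ≫ e ▷ X = (λ_ X).inv) (hd : d ≫ f ▷ Y = (λ_ Y).inv) :
    ((c ⊗ₘ d) ≫ tensorμ X X Y Y) ≫ ((e ⊗ₘ f) ≫ (λ_ (𝟙_ C)).hom) ▷ (X ⊗ Y) =
      (λ_ (X ⊗ Y)).inv := by
  have h := leftUnitor_monoidal X Y
  rw [comp_whiskerRight, Category.assoc, ← tensorHom_id, ← id_tensorHom_id,
    ← tensorμ_natural_assoc, tensorHom_comp_tensorHom_assoc, tensorHom_id, tensorHom_id, hc, hd,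
    ← cancel_mono (λ_ (X ⊗ Y)).hom, Category.assoc, Category.assoc, ← h, tensorHom_comp_tensorHom,
    Iso.inv_hom_id, Iso.inv_hom_id, Iso.inv_hom_id, id_tensorHom_id]

end Monoidal

/-! ### Monoidal preorders and the duality of `◀` and `▶` -/

/-- A preorder on every hom-set that is compatible with composition and monoidal product. -/
structure IsMonoidalPreorder {C : Type*} [Category* C] [MonoidalCategory C] (r : HomRel C) :
    Prop where
  refl : ∀ {X Y : C} (f : X ⟶ Y), r f f
  trans : ∀ {X Y : C} {f g h : X ⟶ Y}, r f g → r g h → r f h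
  comp : ∀ {X Y Z : C} {f f' : X ⟶ Y} {g g' : Y ⟶ Z}, r f f' → r g g' → r (f ≫ g) (f' ≫ g')
  tensor : ∀ {X Y X' Y' : C} {f f' : X ⟶ Y} {g g' : X' ⟶ Y'},
    r f f' → r g g' → r (f ⊗ₘ g) (f' ⊗ₘ g')

namespace IsMonoidalPreorder

variable {C : Type*} [Category* C] [MonoidalCategory C] {r : HomRel C} (hr : IsMonoidalPreorder r)
include hr

theorem precomp {X Y Z : C} (f : X ⟶ Y) {g g' : Y ⟶ Z} (h : r g g') : r (f ≫ g) (f ≫ g') :=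
  hr.comp (hr.refl f) h

theorem postcomp {X Y Z : C} {f f' : X ⟶ Y} (h : r f f') (g : Y ⟶ Z) : r (f ≫ g) (f' ≫ g) :=
  hr.comp h (hr.refl g)

theorem whiskerLeft (X : C) {Y Z : C} {f f' : Y ⟶ Z} (h : r f f') : r (X ◁ f) (X ◁ f') := by
  rw [← id_tensorHom, ← id_tensorHom]
  exact hr.tensor (hr.refl _) h

end IsMonoidalPreorder

/-- The object with a single wire. -/
def Obj.of (x : Dir) : Obj α := ([x] : List Dir)

/-- The diagram class of `cup`. -/
def cupHom : 𝟙_ (Obj α) ⟶ Obj.of .left ⊗ Obj.of .right := Class.mk Diagram.cup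

/-- The diagram class of `cap`. -/
def capHom : Obj.of .left ⊗ Obj.of .right ⟶ 𝟙_ (Obj α) := Class.mk Diagram.cap

/-- The wires `◀` and `▶` are dual. -/
@[reducible]
def wirePairing : ExactPairing (Obj.of (α := α) .left) (Obj.of .right) where
  coevaluation' := cupHom
  evaluation' := (β_ _ _).hom ≫ capHom
  coevaluation_evaluation' := by
    refine (congrArg _ (Class.id_comp _)).trans (Eq.trans ?_ (Class.id_comp _).symm)
    exact Class.eq_of_axiom .A1
  evaluation_coevaluation' := by
    refine (congrArg _ (Class.id_comp _)).trans (Eq.trans ?_ (Class.id_comp _).symm)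
    exact Class.eq_of_axiom .A2

theorem braiding_comp_evaluation :
    (β_ (Obj.of (α := α) .left) (Obj.of .right)).hom ≫ wirePairing.evaluation' = capHom :=
  SymmetricCategory.symmetry_assoc _ _ _

/-! ### Operations on lists of wires and their preservation -/

/-- A multiplication, a comultiplication and their units on the wire `▶`. -/
structure Operations (α : Type u) where
  /-- The multiplication. -/
  mul : Obj.of (α := α) .right ⊗ Obj.of .right ⟶ Obj.of .right
  /-- The unit. -/
  one : 𝟙_ (Obj α) ⟶ Obj.of .right
  /-- The comultiplication. -/
  comul : Obj.of (α := α) .right ⟶ Obj.of .right ⊗ Obj.of .right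
  /-- The counit. -/
  counit : Obj.of (α := α) .right ⟶ 𝟙_ (Obj α)

namespace Operations

variable (S : Operations α)

/-- The multiplication on `▶`, and the mate of the comultiplication on `◀`. -/
def mulOf : (x : Dir) → (Obj.of (α := α) x ⊗ Obj.of x ⟶ Obj.of x)
  | .right => S.mul
  | .left => leftMate wirePairing (squarePairing wirePairing) S.comul

/-- The unit on `▶`, and the mate of the counit on `◀`. -/
def oneOf : (x : Dir) → (𝟙_ (Obj α) ⟶ Obj.of x)
  | .right => S.one
  | .left => leftMate wirePairing exactPairingUnit S.counit

/-- The componentwise multiplication on a list of wires. -/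
def mulOn : (A : List Dir) → ((show Obj α from A) ⊗ (show Obj α from A) ⟶ (show Obj α from A))
  | [] => (λ_ (𝟙_ (Obj α))).hom
  | x :: A => tensorMul (X := Obj.of x) (Y := (show Obj α from A)) (S.mulOf x) (mulOn A)

/-- The componentwise unit on a list of wires. -/
def oneOn : (A : List Dir) → (𝟙_ (Obj α) ⟶ (show Obj α from A))
  | [] => 𝟙 (𝟙_ (Obj α))
  | x :: A => (λ_ (𝟙_ (Obj α))).inv ≫
      MonoidalCategoryStruct.tensorHom (Y₂ := (show Obj α from A)) (S.oneOf x) (oneOn A)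

theorem mulOn_tensor (A B : Obj α) :
    S.mulOn (A ⊗ B : Obj α) = tensorMul (S.mulOn A) (S.mulOn B) := by
  induction A with
  | nil =>
    have h := leftUnitor_tensorMul (S.mulOn B)
    refine Eq.symm ((Category.comp_id _).symm.trans (h.trans ?_))
    exact (congrArg (· ≫ _) (id_tensorHom_id B B)).trans (Category.id_comp _)
  | cons x A ih =>
    have h := associator_tensorMul (X := Obj.of x) (Y := (show Obj α from A)) (S.mulOf x)
      (S.mulOn A) (S.mulOn B)
    rw [← ih] at h
    -- `(x :: A) ++ B` and `x :: (A ++ B)` are definitionally equal, so the associators in `h` are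
    -- identities and can be dropped.
    refine Eq.symm ((Category.comp_id _).symm.trans (h.trans ?_))
    exact (congrArg (· ≫ _) (id_tensorHom_id _ _)).trans (Category.id_comp _)

theorem oneOn_tensor (A B : Obj α) :
    S.oneOn (A ⊗ B : Obj α) = (λ_ (𝟙_ (Obj α))).inv ≫ (S.oneOn A ⊗ₘ S.oneOn B) := by
  induction A with
  | nil =>
    have h : (λ_ (𝟙_ (Obj α))).inv ≫ (𝟙 (𝟙_ (Obj α)) ⊗ₘ S.oneOn B) ≫ (λ_ B).hom = S.oneOn B := by
      simp
    exact h.symm.trans (congrArg (_ ≫ ·) (Category.comp_id _))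
  | cons x A ih =>
    have h := associator_one (Y := (show Obj α from A)) (S.oneOf x) (S.oneOn A) (S.oneOn B)
    rw [← ih] at h
    refine Eq.symm (Eq.trans ?_ h)
    exact congrArg (_ ≫ ·) (Category.comp_id _).symm

theorem mulOn_of (x : Dir) : S.mulOn (Obj.of x : Obj α) = S.mulOf x := by
  have h := rightUnitor_tensorMul (S.mulOf x)
  refine (Category.comp_id _).symm.trans (h.trans ?_)
  exact (congrArg (· ≫ _) (id_tensorHom_id _ _)).trans (Category.id_comp _)

theorem oneOn_of (x : Dir) : S.oneOn (Obj.of x : Obj α) = S.oneOf x := by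
  have h : (λ_ (𝟙_ (Obj α))).inv ≫ (S.oneOf x ⊗ₘ 𝟙 (𝟙_ (Obj α))) ≫ (ρ_ _).hom = S.oneOf x := by
    simp [← unitors_equal]
  exact Eq.trans (congrArg (_ ≫ ·) (Category.comp_id _).symm) h

/-- `S.Preserves r f` says that `f` preserves the operations up to the relation `r`. -/
structure Preserves (r : HomRel (Obj α)) {A B : Obj α} (f : A ⟶ B) : Prop where
  mul : r ((f ⊗ₘ f) ≫ S.mulOn B) (S.mulOn A ≫ f)
  one : r (S.oneOn B) (S.oneOn A ≫ f)

variable {S} {r : HomRel (Obj α)} (hr : IsMonoidalPreorder r)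

namespace Preserves

include hr

theorem id (A : Obj α) : S.Preserves r (𝟙 A) where
  mul := by
    rw [id_tensorHom_id, Category.id_comp, Category.comp_id]
    exact hr.refl _
  one := by
    rw [Category.comp_id]
    exact hr.refl _

theorem comp {A B C : Obj α} {f : A ⟶ B} {g : B ⟶ C} (hf : S.Preserves r f)
    (hg : S.Preserves r g) : S.Preserves r (f ≫ g) where
  mul := by
    rw [← tensorHom_comp_tensorHom, Category.assoc, ← Category.assoc (S.mulOn A)]
    refine hr.trans (hr.precomp _ hg.mul) ?_
    rw [← Category.assoc]
    exact hr.postcomp hf.mul g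
  one := by
    rw [← Category.assoc]
    exact hr.trans hg.one (hr.postcomp hf.one g)

theorem tensor {A B C D : Obj α} {f : A ⟶ B} {g : C ⟶ D} (hf : S.Preserves r f)
    (hg : S.Preserves r g) : S.Preserves r (f ⊗ₘ g) where
  mul := by
    rw [mulOn_tensor, mulOn_tensor, tensorMul, tensorMul, tensorμ_natural_assoc,
      tensorHom_comp_tensorHom, Category.assoc, tensorHom_comp_tensorHom]
    exact hr.precomp _ (hr.tensor hf.mul hg.mul)
  one := by
    rw [oneOn_tensor, oneOn_tensor, Category.assoc, tensorHom_comp_tensorHom]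
    exact hr.precomp _ (hr.tensor hf.one hg.one)

theorem braiding (A B : Obj α) : S.Preserves r (β_ A B).hom where
  mul := by
    rw [mulOn_tensor, mulOn_tensor, braiding_tensorMul]
    exact hr.refl _
  one := by
    rw [oneOn_tensor, oneOn_tensor, Category.assoc, braiding_one]
    exact hr.refl _

end Preserves

variable (S r) in
/-- The multiplication and the unit are adjoint to the comultiplication and the counit, for a
relation `r` that compares morphisms. -/
structure IsAdjoint : Prop where
  comul_mul : r (S.comul ≫ S.mul) (𝟙 _)
  mul_comul : r (𝟙 _) (S.mul ≫ S.comul)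
  counit_one : r (S.counit ≫ S.one) (𝟙 _)
  one_counit : r (𝟙 _) (S.one ≫ S.counit)

include hr in
-- After sliding the mate, multiplying two cups yields one cup with `comul ≫ mul` on its `▶` strand,
-- which `comul_mul` compares with the identity. The unit is treated in the same way by
-- `counit_one`.
theorem IsAdjoint.preserves_cup (h : S.IsAdjoint r) : S.Preserves r (cupHom (α := α)) where
  mul := by
    rw [mulOn_tensor, mulOn_of, mulOn_of]
    have e := cup_comp_leftMate_tensor (wirePairing (α := α)) S.comul S.mul
    have k : r (wirePairing.coevaluation' ≫ Obj.of (α := α) .left ◁ (S.comul ≫ S.mul)) cupHom := by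
      conv => arg 2; rw [← Category.comp_id cupHom, ← MonoidalCategory.whiskerLeft_id]
      exact hr.precomp _ (hr.whiskerLeft _ h.comul_mul)
    refine Eq.mp (congrArg (r · _) e.symm) ?_
    exact hr.precomp _ k
  one := by
    rw [oneOn_tensor, oneOn_of, oneOn_of]
    have e := cup_eq_leftMate_tensor (wirePairing (α := α)) S.counit S.one
    have k : r (wirePairing.coevaluation' ≫ Obj.of (α := α) .left ◁ (S.counit ≫ S.one)) cupHom := by
      conv => arg 2; rw [← Category.comp_id cupHom, ← MonoidalCategory.whiskerLeft_id]
      exact hr.precomp _ (hr.whiskerLeft _ h.counit_one)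
    refine Eq.mp (congrArg (r · _) e.symm) ?_
    exact Eq.mp (congrArg (r _) (Category.id_comp _).symm) k

include hr in
-- Dual to the cup: multiplying and then capping amounts to two caps with `mul ≫ comul` inserted on
-- the `▶` strands, so the other half of the adjunction applies.
theorem IsAdjoint.preserves_cap (h : S.IsAdjoint r) : S.Preserves r (capHom (α := α)) where
  mul := by
    rw [mulOn_tensor, mulOn_of, mulOn_of]
    have e := leftMate_tensor_comp_cap (wirePairing (α := α)) S.comul S.mul
    rw [braiding_comp_evaluation] at e
    have k : r ((capHom (α := α) ⊗ₘ capHom) ≫ (λ_ _).hom)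
        (tensorμ _ _ _ _ ≫ (_ ◁ (S.mul ≫ S.comul)) ≫ tensorμ _ _ _ _ ≫ (capHom ⊗ₘ capHom) ≫
          (λ_ _).hom) := by
      -- Two mutually inverse middle exchanges are inserted; between them the two `▶` strands are
      -- adjacent, so `mul ≫ comul` can be introduced there.
      conv =>
        arg 1
        rw [← Category.id_comp ((capHom (α := α) ⊗ₘ capHom) ≫ (λ_ _).hom), ← tensorμ_tensorμ,
          Category.assoc, ← Category.id_comp (tensorμ _ _ _ _ ≫ (capHom ⊗ₘ capHom) ≫ _),
          ← MonoidalCategory.whiskerLeft_id]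
      exact hr.precomp _ (hr.postcomp (hr.whiskerLeft _ h.mul_comul) _)
    rw [← e] at k
    exact Eq.mp (congrArg (r _) (Category.assoc _ _ _).symm) k
  one := by
    rw [oneOn_tensor, oneOn_of, oneOn_of]
    have e := leftMate_tensor_comp_cap_unit (wirePairing (α := α)) S.counit S.one
    rw [braiding_comp_evaluation] at e
    have k := h.one_counit
    rw [← e] at k
    exact Eq.mp (congrArg (r _) (Category.assoc _ _ _).symm) k

end Operations

/-! ### The generators and axioms in the quotient category -/

/-- The object `▶`. -/
abbrev Obj.wire : Obj α := Obj.of .right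

/-- The diagram class of `copy`. -/
def copyHom : Obj.wire (α := α) ⟶ Obj.wire ⊗ Obj.wire := Class.mk Diagram.copy
/-- The diagram class of `del`. -/
def delHom : Obj.wire (α := α) ⟶ 𝟙_ (Obj α) := Class.mk Diagram.del
/-- The diagram class of `merge`. -/
def mergeHom : Obj.wire (α := α) ⊗ Obj.wire ⟶ Obj.wire := Class.mk Diagram.merge
/-- The diagram class of `gen`. -/
def genHom : 𝟙_ (Obj α) ⟶ Obj.wire := Class.mk Diagram.gen
/-- The diagram class of a letter. -/
def actHom (a : α) : Obj.wire (α := α) ⟶ Obj.wire := Class.mk (Diagram.act a)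
/-- The diagram class of `wmult`. -/
def wmultHom : Obj.wire (α := α) ⊗ Obj.wire ⟶ Obj.wire := Class.mk Diagram.wmult
/-- The diagram class of `wunit`. -/
def wunitHom : 𝟙_ (Obj α) ⟶ Obj.wire := Class.mk Diagram.wunit
/-- The diagram class of `wcomult`. -/
def wcomultHom : Obj.wire (α := α) ⟶ Obj.wire ⊗ Obj.wire := Class.mk Diagram.wcomult
/-- The diagram class of `wcounit`. -/
def wcounitHom : Obj.wire (α := α) ⟶ 𝟙_ (Obj α) := Class.mk Diagram.wcounit

/-- The associators in `tensorμ` are identities on these lists, which leaves only the middle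
crossing. -/
theorem mk_cross : Class.mk (Diagram.cross (α := α)) =
    tensorμ Obj.wire Obj.wire Obj.wire Obj.wire := by
  have h := Class.tensor_assoc (α := α) (Class.idOfEq (rfl : [Dir.right] = [Dir.right]))
    (Class.swap [Dir.right] [Dir.right]) (Class.idOfEq (rfl : [Dir.right] = [Dir.right]))
  refine ((Class.comp_id _).symm.trans (h.trans (Class.id_comp _))).trans ?_
  have k : Obj.wire (α := α) ◁ (α_ Obj.wire Obj.wire Obj.wire).inv = 𝟙 _ :=
    whiskerLeft_id _ _
  have k' : Obj.wire (α := α) ◁ (α_ Obj.wire Obj.wire Obj.wire).hom = 𝟙 _ :=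
    whiskerLeft_id _ _
  simp only [tensorμ]
  rw [k, k']
  refine Eq.symm ((Category.id_comp _).trans ((Category.id_comp _).trans ?_))
  exact (congrArg (_ ≫ ·) (Category.id_comp _)).trans (Category.comp_id _)

theorem braiding_comp_mergeHom :
    (β_ (Obj.wire (α := α)) Obj.wire).hom ≫ mergeHom = mergeHom := Class.eq_of_axiom .B6

theorem copyHom_comp_braiding :
    copyHom (α := α) ≫ (β_ Obj.wire Obj.wire).hom = copyHom := Class.eq_of_axiom .B3

theorem wire_whiskerLeft_genHom :
    Obj.wire (α := α) ◁ genHom ≫ mergeHom = (ρ_ _).hom := Class.eq_of_axiom .B5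

theorem copyHom_comp_wire_whiskerLeft :
    copyHom (α := α) ≫ Obj.wire ◁ delHom = (ρ_ _).inv := Class.eq_of_axiom .B2

theorem genHom_whiskerRight_wire :
    genHom ▷ Obj.wire (α := α) ≫ mergeHom = (λ_ _).hom := by
  rw [← braiding_comp_mergeHom, BraidedCategory.braiding_naturality_left_assoc,
    wire_whiskerLeft_genHom, braiding_rightUnitor]

theorem copyHom_comp_whiskerRight_wire :
    copyHom (α := α) ≫ delHom ▷ Obj.wire = (λ_ _).inv := by
  rw [← copyHom_comp_braiding, Category.assoc, ← BraidedCategory.braiding_naturality_right,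
    ← Category.assoc, copyHom_comp_wire_whiskerLeft, rightUnitor_inv_braiding]

instance : MonObj (Obj.wire (α := α)) where
  one := genHom
  mul := mergeHom
  one_mul := genHom_whiskerRight_wire
  mul_one := wire_whiskerLeft_genHom
  mul_assoc := Eq.trans (Class.eq_of_axiom .B4) (Class.id_comp _).symm

instance : IsCommMonObj (Obj.wire (α := α)) where
  mul_comm := braiding_comp_mergeHom

theorem wunitHom_comp_copyHom :
    wunitHom ≫ copyHom (α := α) = (λ_ (𝟙_ (Obj α))).inv ≫ (wunitHom ⊗ₘ wunitHom) :=
  Eq.trans (Class.eq_of_axiom .D1) (Class.id_comp _).symm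

theorem wmultHom_comp_copyHom :
    wmultHom ≫ copyHom (α := α) =
      (copyHom ⊗ₘ copyHom) ≫ tensorμ _ _ _ _ ≫ (wmultHom ⊗ₘ wmultHom) := by
  rw [← Category.assoc, ← mk_cross]
  exact Class.eq_of_axiom .D2

theorem wmultHom_comp_delHom :
    wmultHom ≫ delHom (α := α) = (delHom ⊗ₘ delHom) ≫ (λ_ (𝟙_ (Obj α))).hom :=
  Eq.trans (Class.eq_of_axiom .D3) (Class.comp_id _).symm

theorem genHom_comp_copyHom :
    genHom ≫ copyHom (α := α) = (λ_ (𝟙_ (Obj α))).inv ≫ (genHom ⊗ₘ genHom) :=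
  Eq.trans (Class.eq_of_axiom .B8) (Class.id_comp _).symm

theorem mergeHom_comp_copyHom :
    mergeHom ≫ copyHom (α := α) =
      (copyHom ⊗ₘ copyHom) ≫ tensorμ _ _ _ _ ≫ (mergeHom ⊗ₘ mergeHom) := by
  rw [← Category.assoc, ← mk_cross]
  exact Class.eq_of_axiom .B7

theorem mergeHom_comp_delHom :
    mergeHom ≫ delHom (α := α) = (delHom ⊗ₘ delHom) ≫ (λ_ (𝟙_ (Obj α))).hom :=
  Eq.trans (Class.eq_of_axiom .B9) (Class.comp_id _).symm

theorem genHom_comp_delHom : genHom ≫ delHom (α := α) = 𝟙 _ := Class.eq_of_axiom .B11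

theorem copyHom_comp_mergeHom : copyHom ≫ mergeHom (α := α) = 𝟙 _ := Class.eq_of_axiom .B10

theorem lax_mergeHom : (mergeHom (α := α) ⊗ₘ mergeHom) ≫ wmultHom ≤
    tensorμ _ _ _ _ ≫ (wmultHom ⊗ₘ wmultHom) ≫ mergeHom := by
  rw [← Category.assoc, ← mk_cross]
  exact Class.le_of_axiom .E1

theorem lax_genHom : (genHom (α := α) ⊗ₘ genHom) ≫ wmultHom ≤ (λ_ (𝟙_ (Obj α))).hom ≫ genHom :=
  LE.le.trans_eq (Class.le_of_axiom .E2) (Class.id_comp _).symm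


theorem wmultHom_comp_actHom (a : α) :
    (actHom a ⊗ₘ actHom a) ≫ wmultHom = wmultHom ≫ actHom a := Class.eq_of_axiom (.E8 a)

theorem wunitHom_comp_actHom (a : α) : wunitHom ≫ actHom a = wunitHom :=
  (Class.eq_of_axiom (.E9 a)).symm

theorem mergeHom_comp_actHom (a : α) :
    (actHom a ⊗ₘ actHom a) ≫ mergeHom = mergeHom ≫ actHom a := (Class.eq_of_axiom (.E10 a)).symm

theorem genHom_comp_actHom (a : α) : genHom ≫ actHom a = genHom := Class.eq_of_axiom (.E11 a)

theorem isMonoidalPreorder_le : IsMonoidalPreorder (C := Obj α) fun _ _ f g => f ≤ g where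
  refl := le_refl
  trans := le_trans
  comp := Class.comp_mono
  tensor := Class.tensor_mono

theorem isMonoidalPreorder_ge : IsMonoidalPreorder (C := Obj α) fun _ _ f g => g ≤ f where
  refl := le_refl
  trans h k := le_trans k h
  comp := Class.comp_mono
  tensor := Class.tensor_mono

/-! ### Three adjunctions respected by automata-diagrams -/

namespace Operations

/-- Preservation is stable under composition and product, and the bending of wires is where the
adjunction enters; the remaining generators involve only `▶`. -/
theorem IsAdjoint.preserves_of_isAutomaton {S : Operations α} {r : HomRel (Obj α)}
    (hr : IsMonoidalPreorder r) (h : S.IsAdjoint r) (h_copy : S.Preserves r (copyHom (α := α)))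
    (h_del : S.Preserves r (delHom (α := α))) (h_merge : S.Preserves r (mergeHom (α := α)))
    (h_gen : S.Preserves r (genHom (α := α))) (h_act : ∀ a, S.Preserves r (actHom a))
    {A B : List Dir} {d : Diagram α A B} (hd : IsAutomaton d) :
    S.Preserves r (show ((show Obj α from A) ⟶ (show Obj α from B)) from Class.mk d) := by
  induction hd with
  | copy => exact h_copy
  | del => exact h_del
  | merge => exact h_merge
  | gen => exact h_gen
  | act a => exact h_act a
  | cap => exact h.preserves_cap hr
  | cup => exact h.preserves_cup hr
  | id A => exact Preserves.id hr _
  | swap A B => exact Preserves.braiding hr _ _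
  | comp _ _ hc hd => exact Preserves.comp hr hc hd
  | tensor _ _ hc hd => exact Preserves.tensor hr hc hd

/-- The white monoid with the black comonoid, to which it is left adjoint. -/
def whiteBlack (α : Type u) : Operations α := ⟨wmultHom, wunitHom, copyHom, delHom⟩

/-- The black monoid with the white comonoid, to which it is left adjoint. -/
def blackWhite (α : Type u) : Operations α := ⟨mergeHom, genHom, wcomultHom, wcounitHom⟩

/-- The black monoid with the black comonoid, to which it is right adjoint. -/
def black (α : Type u) : Operations α := ⟨mergeHom, genHom, copyHom, delHom⟩

theorem whiteBlack_isAdjoint : (whiteBlack α).IsAdjoint fun _ _ f g => f ≤ g where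
  comul_mul := Class.le_of_axiom .F7
  mul_comul := LE.le.trans_eq' (Class.le_of_axiom .F5) (id_tensorHom_id Obj.wire Obj.wire)
  counit_one := Class.le_of_axiom .F6
  one_counit := Class.le_of_axiom .F8

theorem blackWhite_isAdjoint : (blackWhite α).IsAdjoint fun _ _ f g => f ≤ g where
  comul_mul := Class.le_of_axiom .F11
  mul_comul := LE.le.trans_eq' (Class.le_of_axiom .F9) (id_tensorHom_id Obj.wire Obj.wire)
  counit_one := Class.le_of_axiom .F10
  one_counit := Class.le_of_axiom .F12

theorem black_isAdjoint : (black α).IsAdjoint fun _ _ f g => g ≤ f where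
  comul_mul := Class.le_of_axiom .F3
  mul_comul := LE.le.trans_eq (Class.le_of_axiom .F1) (id_tensorHom_id Obj.wire Obj.wire)
  counit_one := Class.le_of_axiom .F2
  one_counit := Class.le_of_axiom .F4

theorem whiteBlack_preserves {A B : List Dir} {d : Diagram α A B} (hd : IsAutomaton d) :
    (whiteBlack α).Preserves (fun _ _ f g => f ≤ g)
      (show ((show Obj α from A) ⟶ (show Obj α from B)) from Class.mk d) := by
  refine whiteBlack_isAdjoint.preserves_of_isAutomaton isMonoidalPreorder_le ⟨?_, ?_⟩ ⟨?_, ?_⟩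
    ⟨?_, ?_⟩ ⟨?_, ?_⟩ (fun a => ⟨?_, ?_⟩) hd
  · rw [mulOn_tensor, mulOn_of]
    exact wmultHom_comp_copyHom.ge
  · rw [oneOn_tensor, oneOn_of]
    exact wunitHom_comp_copyHom.ge
  · rw [mulOn_of]
    exact wmultHom_comp_delHom.ge
  · rw [oneOn_of]
    exact Class.le_of_axiom .F8
  · rw [mulOn_tensor, mulOn_of]
    exact lax_mergeHom.trans_eq (Category.assoc _ _ _).symm
  · rw [oneOn_tensor, oneOn_of]
    change wunitHom ≤ ((λ_ (𝟙_ (Obj α))).inv ≫ (wunitHom ⊗ₘ wunitHom)) ≫ mergeHom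
    -- In fact an equality: `u ⊕ u` is `u;Δ`, and `Δ;∇` is the identity.
    rw [← wunitHom_comp_copyHom, Category.assoc, copyHom_comp_mergeHom, Category.comp_id]
  · rw [mulOn_of]
    exact lax_genHom
  · rw [oneOn_of]
    change wunitHom ≤ 𝟙 (𝟙_ (Obj α)) ≫ genHom
    -- That `u ≤ ?` follows from `!;u ≤ 1` after precomposing with `?`, since `?;!` is empty.
    have h : genHom ≫ delHom ≫ wunitHom ≤ genHom ≫ 𝟙 (Obj.wire (α := α)) :=
      Class.comp_mono le_rfl (Class.le_of_axiom .F6)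
    rw [← Category.assoc, genHom_comp_delHom, Category.id_comp, Category.comp_id] at h
    rwa [Category.id_comp]
  · rw [mulOn_of]
    exact (wmultHom_comp_actHom a).le
  · rw [oneOn_of]
    exact (wunitHom_comp_actHom a).ge

/-- The comultiplication of `S` matters only on `◀`, hence only for cup and cap. Every other
generator commutes strictly with ∇ and ?, so reflexivity of `r` suffices. This allows two different
comultiplications with opposite orders. -/
theorem preserves_of_mul_eq_mergeHom {S : Operations α} {r : HomRel (Obj α)}
    (hr : IsMonoidalPreorder r) (h : S.IsAdjoint r) (hm : S.mul = mergeHom) (ho : S.one = genHom)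
    {A B : List Dir} {d : Diagram α A B} (hd : IsAutomaton d) :
    S.Preserves r (show ((show Obj α from A) ⟶ (show Obj α from B)) from Class.mk d) := by
  have of_eq {X Y : Obj α} {f g : X ⟶ Y} (h : f = g) : r f g := h ▸ hr.refl f
  refine h.preserves_of_isAutomaton hr ⟨of_eq ?_, of_eq ?_⟩ ⟨of_eq ?_, of_eq ?_⟩
    ⟨of_eq ?_, of_eq ?_⟩ ⟨of_eq ?_, of_eq ?_⟩ (fun a => ⟨of_eq ?_, of_eq ?_⟩) hd
  · rw [mulOn_tensor, mulOn_of, mulOf, hm]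
    exact mergeHom_comp_copyHom.symm
  · rw [oneOn_tensor, oneOn_of, oneOf, ho]
    exact genHom_comp_copyHom.symm
  · rw [mulOn_of, mulOf, hm]
    exact mergeHom_comp_delHom.symm
  · rw [oneOn_of, oneOf, ho]
    exact genHom_comp_delHom.symm
  · rw [mulOn_tensor, mulOn_of, mulOf, hm, Category.assoc]
    -- The multiplication of a commutative monoid is itself a homomorphism.
    exact (MonObj.mul_mul_mul_comm (Obj.wire (α := α))).symm
  · rw [oneOn_tensor, oneOn_of, oneOf, ho, Category.assoc]
    have h := MonObj.one_mul (Obj.wire (α := α))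
    change genHom ▷ _ ≫ mergeHom = _ at h
    rw [MonoidalCategory.tensorHom_def', Category.assoc, h]
    simp
  · rw [mulOn_of, mulOf, hm]
    change _ = (λ_ (𝟙_ (Obj α))).hom ≫ genHom
    have h := genHom_whiskerRight_wire (α := α)
    rw [MonoidalCategory.tensorHom_def', Category.assoc, h]
    simp
  · rw [oneOn_of, oneOf, ho]
    exact (Category.id_comp _).symm
  · rw [mulOn_of, mulOf, hm]
    exact mergeHom_comp_actHom a
  · rw [oneOn_of, oneOf, ho]
    exact (genHom_comp_actHom a).symm

theorem blackWhite_preserves {A B : List Dir} {d : Diagram α A B} (hd : IsAutomaton d) :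
    (blackWhite α).Preserves (fun _ _ f g => f ≤ g)
      (show ((show Obj α from A) ⟶ (show Obj α from B)) from Class.mk d) :=
  preserves_of_mul_eq_mergeHom isMonoidalPreorder_le blackWhite_isAdjoint rfl rfl hd

theorem black_preserves {A B : List Dir} {d : Diagram α A B} (hd : IsAutomaton d) :
    (black α).Preserves (fun _ _ f g => g ≤ f)
      (show ((show Obj α from A) ⟶ (show Obj α from B)) from Class.mk d) :=
  preserves_of_mul_eq_mergeHom isMonoidalPreorder_ge black_isAdjoint rfl rfl hd

end Operations

/-! ### Adjunctions on `▶^n` and passage to the comultiplication -/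

/-- The object `▶^n`. -/
def Obj.wires (n : ℕ) : Obj α := rights n

namespace Operations

variable (S : Operations α)

/-- The multiplication on `▶^n`. -/
def mulWires (n : ℕ) : Obj.wires (α := α) n ⊗ Obj.wires n ⟶ Obj.wires n := S.mulOn (rights n)

/-- The unit on `▶^n`. -/
def oneWires (n : ℕ) : 𝟙_ (Obj α) ⟶ Obj.wires n := S.oneOn (rights n)

/-- The comultiplication on `▶^n`. -/
def comulWires : (n : ℕ) → (Obj.wires (α := α) n ⟶ Obj.wires n ⊗ Obj.wires n)
  | 0 => (λ_ (𝟙_ (Obj α))).inv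
  | n + 1 => (S.comul ⊗ₘ comulWires n) ≫ tensorμ _ _ _ _

/-- The counit on `▶^n`. -/
def counitWires : (n : ℕ) → (Obj.wires (α := α) n ⟶ 𝟙_ (Obj α))
  | 0 => 𝟙 (𝟙_ (Obj α))
  | n + 1 => (S.counit ⊗ₘ counitWires n) ≫ (λ_ (𝟙_ (Obj α))).hom

theorem oneWires_whiskerRight_mulWires (h : S.one ▷ Obj.wire ≫ S.mul = (λ_ Obj.wire).hom) (n : ℕ) :
    S.oneWires n ▷ Obj.wires n ≫ S.mulWires n = (λ_ (Obj.wires n)).hom := by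
  induction n with
  | zero =>
    have e : 𝟙 (𝟙_ (Obj α)) ▷ 𝟙_ (Obj α) ≫ (λ_ (𝟙_ (Obj α))).hom = (λ_ (𝟙_ (Obj α))).hom := by
      simp
    exact e
  | succ n ih => exact tensorMul_one h ih

theorem comulWires_whiskerRight_counitWires
    (h : S.comul ≫ S.counit ▷ Obj.wire = (λ_ Obj.wire).inv) (n : ℕ) :
    S.comulWires n ≫ S.counitWires n ▷ Obj.wires n = (λ_ (Obj.wires n)).inv := by
  induction n with
  | zero =>
    have e : (λ_ (𝟙_ (Obj α))).inv ≫ 𝟙 (𝟙_ (Obj α)) ▷ 𝟙_ (Obj α) = (λ_ (𝟙_ (Obj α))).inv := by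
      simp
    exact e
  | succ n ih => exact tensorComul_counit h ih

/-- On `▶^n` no mates occur, so the multiplication does not depend on the comultiplication of `S`.
This lets inequalities obtained from different adjunctions be compared. -/
theorem mulWires_congr {S T : Operations α} (h : S.mul = T.mul) (n : ℕ) :
    S.mulWires n = T.mulWires n := by
  induction n with
  | zero => rfl
  | succ n ih => exact congrArg₂ tensorMul h ih

theorem oneWires_congr {S T : Operations α} (h : S.one = T.one) (n : ℕ) :
    S.oneWires n = T.oneWires n := by
  induction n with
  | zero => rfl
  | succ n ih => exact congrArg (_ ≫ ·) (congrArg₂ tensorHom h ih)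

theorem comulWires_congr {S T : Operations α} (h : S.comul = T.comul) (n : ℕ) :
    S.comulWires n = T.comulWires n := by
  induction n with
  | zero => rfl
  | succ n ih => exact congrArg (· ≫ _) (congrArg₂ tensorHom h ih)

theorem counitWires_congr {S T : Operations α} (h : S.counit = T.counit) (n : ℕ) :
    S.counitWires n = T.counitWires n := by
  induction n with
  | zero => rfl
  | succ n ih => exact congrArg (· ≫ _) (congrArg₂ tensorHom h ih)

variable {S} {r : HomRel (Obj α)} (hr : IsMonoidalPreorder r)

namespace IsAdjoint

include hr

theorem mulWires_comulWires (h : S.IsAdjoint r) (n : ℕ) :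
    r (𝟙 _) (S.mulWires n ≫ S.comulWires n) := by
  induction n with
  | zero =>
    have e : (λ_ (𝟙_ (Obj α))).hom ≫ (λ_ (𝟙_ (Obj α))).inv = 𝟙 _ := Iso.hom_inv_id _
    exact Eq.mp (congrArg (r _) e.symm) (hr.refl _)
  | succ n ih =>
    have k := hr.precomp (tensorμ Obj.wire (Obj.wires n) Obj.wire (Obj.wires n))
      (hr.postcomp (hr.tensor h.mul_comul ih) (tensorμ Obj.wire Obj.wire (Obj.wires n)
        (Obj.wires n)))
    rw [id_tensorHom_id, Category.id_comp, tensorμ_tensorμ, ← tensorMul_comp_tensorComul] at k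
    exact k

theorem comulWires_mulWires (h : S.IsAdjoint r) (n : ℕ) :
    r (S.comulWires n ≫ S.mulWires n) (𝟙 _) := by
  induction n with
  | zero =>
    have e : (λ_ (𝟙_ (Obj α))).inv ≫ (λ_ (𝟙_ (Obj α))).hom = 𝟙 _ := Iso.inv_hom_id _
    exact Eq.mp (congrArg (r · _) e.symm) (hr.refl _)
  | succ n ih =>
    have k := hr.tensor h.comul_mul ih
    rw [id_tensorHom_id, ← tensorComul_comp_tensorMul] at k
    exact k

theorem oneWires_counitWires (h : S.IsAdjoint r) (n : ℕ) :
    r (𝟙 _) (S.oneWires n ≫ S.counitWires n) := by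
  induction n with
  | zero =>
    have e : 𝟙 (𝟙_ (Obj α)) ≫ 𝟙 (𝟙_ (Obj α)) = 𝟙 _ := Category.comp_id _
    exact Eq.mp (congrArg (r _) e.symm) (hr.refl _)
  | succ n ih =>
    have k := hr.precomp (λ_ (𝟙_ (Obj α))).inv
      (hr.postcomp (hr.tensor h.one_counit ih) (λ_ (𝟙_ (Obj α))).hom)
    rw [id_tensorHom_id, Category.id_comp, Iso.inv_hom_id,
      ← tensorHom_comp_tensorHom_assoc, ← Category.assoc] at k
    exact k

theorem counitWires_oneWires (h : S.IsAdjoint r) (n : ℕ) :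
    r (S.counitWires n ≫ S.oneWires n) (𝟙 _) := by
  induction n with
  | zero =>
    have e : 𝟙 (𝟙_ (Obj α)) ≫ 𝟙 (𝟙_ (Obj α)) = 𝟙 _ := Category.comp_id _
    exact Eq.mp (congrArg (r · _) e.symm) (hr.refl _)
  | succ n ih =>
    have k := hr.tensor h.counit_one ih
    rw [id_tensorHom_id, ← tensorHom_comp_tensorHom,
      ← Iso.hom_inv_id_assoc (λ_ (𝟙_ (Obj α))) (_ ⊗ₘ _), ← Category.assoc] at k
    exact k

/-- Transposition along the adjunction: insert `mul ≫ comul` after `d ⊗ d`, move the multiplication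
past `d`, then remove `comul ≫ mul`. -/
theorem comulWires_comp_tensor (h : S.IsAdjoint r) {m n : ℕ}
    {d : Obj.wires (α := α) m ⟶ Obj.wires n} (hd : S.Preserves r d) :
    r (S.comulWires m ≫ (d ⊗ₘ d)) (d ≫ S.comulWires n) := by
  have k₁ := hr.precomp (S.comulWires m ≫ (d ⊗ₘ d)) (h.mulWires_comulWires hr n)
  have k₂ := hr.precomp (S.comulWires m) (hr.postcomp hd.mul (S.comulWires n))
  have k₃ := hr.postcomp (h.comulWires_mulWires hr m) (d ≫ S.comulWires n)
  simp only [Category.comp_id, Category.id_comp, Category.assoc] at k₁ k₂ k₃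
  exact hr.trans k₁ (hr.trans k₂ k₃)

theorem counitWires_rel (h : S.IsAdjoint r) {m n : ℕ}
    {d : Obj.wires (α := α) m ⟶ Obj.wires n} (hd : S.Preserves r d) :
    r (S.counitWires m) (d ≫ S.counitWires n) := by
  have k₁ := hr.precomp (S.counitWires m) (h.oneWires_counitWires hr n)
  have k₂ := hr.precomp (S.counitWires m) (hr.postcomp hd.one (S.counitWires n))
  have k₃ := hr.postcomp (h.counitWires_oneWires hr m) (d ≫ S.counitWires n)
  simp only [Category.comp_id, Category.id_comp, Category.assoc] at k₁ k₂ k₃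
  exact hr.trans k₁ (hr.trans k₂ k₃)

end IsAdjoint

end Operations

open Operations

/-! ### Linear morphisms and the biproduct decomposition -/

/-- The inclusion of the first wire. -/
def inlHom (n : ℕ) : Obj.wire (α := α) ⟶ Obj.wires (n + 1) :=
  show Obj.wire ⟶ Obj.wire ⊗ Obj.wires n from (ρ_ _).inv ≫ Obj.wire ◁ (black α).oneWires n

/-- The inclusion of all wires but the first. -/
def inrHom (n : ℕ) : Obj.wires (α := α) n ⟶ Obj.wires (n + 1) :=
  show Obj.wires n ⟶ Obj.wire ⊗ Obj.wires n from (λ_ _).inv ≫ genHom ▷ Obj.wires n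

/-- The projection to the first wire. -/
def fstHom (n : ℕ) : Obj.wires (α := α) (n + 1) ⟶ Obj.wire :=
  show Obj.wire ⊗ Obj.wires n ⟶ Obj.wire from Obj.wire ◁ (black α).counitWires n ≫ (ρ_ _).hom

/-- The projection to all wires but the first. -/
def sndHom (n : ℕ) : Obj.wires (α := α) (n + 1) ⟶ Obj.wires n :=
  show Obj.wire ⊗ Obj.wires n ⟶ Obj.wires n from delHom ▷ Obj.wires n ≫ (λ_ _).hom

theorem inclusions_comp_mulWires (n : ℕ) :
    (inlHom (α := α) n ⊗ₘ inrHom n) ≫ (black α).mulWires (n + 1) = 𝟙 (Obj.wires (n + 1)) :=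
  tensor_inclusions_comp_tensorMul wire_whiskerLeft_genHom
    ((black α).oneWires_whiskerRight_mulWires genHom_whiskerRight_wire n)

theorem comulWires_comp_projections (n : ℕ) :
    (black α).comulWires (n + 1) ≫ (fstHom (α := α) n ⊗ₘ sndHom n) = 𝟙 (Obj.wires (n + 1)) :=
  tensorComul_comp_tensor_projections copyHom_comp_wire_whiskerLeft
    ((black α).comulWires_whiskerRight_counitWires copyHom_comp_whiskerRight_wire n)

/-- The laws that an automaton-diagram satisfies for the black monoid and comonoid. -/
structure IsLinear {m n : ℕ} (d : Obj.wires (α := α) m ⟶ Obj.wires n) : Prop where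
  mul : (black α).mulWires m ≫ d = (d ⊗ₘ d) ≫ (black α).mulWires n
  one : (black α).oneWires m ≫ d = (black α).oneWires n
  comul : d ≫ (black α).comulWires n = (black α).comulWires m ≫ (d ⊗ₘ d)
  counit : d ≫ (black α).counitWires n = (black α).counitWires m

/-- The black adjunction, in the reversed order, supplies one inequality of each law. The opposite
ones come from `blackWhite` for ∇ and ?, and from `whiteBlack`, transposed, for Δ and !. -/
theorem IsAutomaton.isLinear {m n : ℕ} {d : Diagram α (rights m) (rights n)}
    (hd : IsAutomaton d) :
    IsLinear (show Obj.wires (α := α) m ⟶ Obj.wires n from Class.mk d) := by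
  have h₁ := whiteBlack_preserves hd
  have h₂ := blackWhite_preserves hd
  have h₃ := black_preserves hd
  have e₁ k : (blackWhite α).mulWires k = (black α).mulWires k :=
    mulWires_congr (S := blackWhite α) (T := black α) rfl k
  have e₂ k : (blackWhite α).oneWires k = (black α).oneWires k :=
    oneWires_congr (S := blackWhite α) (T := black α) rfl k
  have e₃ k : (whiteBlack α).comulWires k = (black α).comulWires k :=
    comulWires_congr (S := whiteBlack α) (T := black α) rfl k
  have e₄ k : (whiteBlack α).counitWires k = (black α).counitWires k :=
    counitWires_congr (S := whiteBlack α) (T := black α) rfl k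
  refine ⟨le_antisymm h₃.mul ?_, le_antisymm h₃.one ?_, le_antisymm ?_ ?_, le_antisymm ?_ ?_⟩
  · have h := h₂.mul
    change _ ≫ (blackWhite α).mulWires n ≤ (blackWhite α).mulWires m ≫ _ at h
    rwa [e₁, e₁] at h
  · have h := h₂.one
    change (blackWhite α).oneWires n ≤ (blackWhite α).oneWires m ≫ _ at h
    rwa [e₂, e₂] at h
  · exact black_isAdjoint.comulWires_comp_tensor isMonoidalPreorder_ge h₃
  · rw [← e₃, ← e₃]
    exact whiteBlack_isAdjoint.comulWires_comp_tensor isMonoidalPreorder_le h₁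
  · exact black_isAdjoint.counitWires_rel isMonoidalPreorder_ge h₃
  · rw [← e₄, ← e₄]
    exact whiteBlack_isAdjoint.counitWires_rel isMonoidalPreorder_le h₁

namespace IsLinear

/-- Precomposing `f` with the decomposition of the identity and using linearity expresses `f` as the
merge of its two restrictions. -/
theorem eq_of_inclusions {m n : ℕ} {d e : Obj.wires (α := α) (m + 1) ⟶ Obj.wires n}
    (hd : IsLinear d) (he : IsLinear e)
    (hl : inlHom m ≫ d = inlHom m ≫ e)
    (hr : inrHom m ≫ d = inrHom m ≫ e) :
    d = e := by
  have k {f : Obj.wires (α := α) (m + 1) ⟶ Obj.wires n} (hf : IsLinear f) :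
      f = ((inlHom m ≫ f) ⊗ₘ (inrHom m ≫ f)) ≫ (black α).mulWires n := by
    rw [← tensorHom_comp_tensorHom, Category.assoc]
    refine Eq.trans ?_ (congrArg (_ ≫ ·) hf.mul)
    refine Eq.trans ?_ (Category.assoc _ _ _)
    exact ((congrArg (· ≫ f) (inclusions_comp_mulWires m)).trans (Category.id_comp f)).symm
  exact (k hd).trans (Eq.trans (congrArg (· ≫ _) (congrArg₂ tensorHom hl hr)) (k he).symm)

theorem eq_of_projections {m n : ℕ} {d e : Obj.wires (α := α) m ⟶ Obj.wires (n + 1)}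
    (hd : IsLinear d) (he : IsLinear e)
    (hl : d ≫ fstHom n = e ≫ fstHom n)
    (hr : d ≫ sndHom n = e ≫ sndHom n) :
    d = e := by
  have k {f : Obj.wires (α := α) m ⟶ Obj.wires (n + 1)} (hf : IsLinear f) :
      f = (black α).comulWires m ≫ ((f ≫ fstHom n) ⊗ₘ (f ≫ sndHom n)) := by
    rw [← tensorHom_comp_tensorHom]
    refine Eq.trans ?_ (Category.assoc _ _ _)
    refine Eq.trans ?_ (congrArg (· ≫ _) hf.comul)
    refine Eq.trans ?_ (Category.assoc _ _ _).symm
    exact ((congrArg (f ≫ ·) (comulWires_comp_projections n)).trans (Category.comp_id f)).symm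
  exact (k hd).trans (Eq.trans (congrArg (_ ≫ ·) (congrArg₂ tensorHom hl hr)) (k he).symm)

/-- The unit on `▶^0` is the identity, so the unit law forces such a morphism to be the unit of
`▶^n`. -/
theorem eq_of_domain_zero {n : ℕ} {d e : Obj.wires (α := α) 0 ⟶ Obj.wires n}
    (hd : IsLinear d) (he : IsLinear e) : d = e :=
  (Category.id_comp d).symm.trans (hd.one.trans (he.one.symm.trans (Category.id_comp e)))

theorem eq_of_codomain_zero {m : ℕ} {d e : Obj.wires (α := α) m ⟶ Obj.wires 0}
    (hd : IsLinear d) (he : IsLinear e) : d = e :=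
  (Category.comp_id d).symm.trans (hd.counit.trans (he.counit.symm.trans (Category.comp_id e)))

end IsLinear

/-! ### Coefficients and the induction on the number of wires -/

theorem IsAutomaton.genAll (m : ℕ) : IsAutomaton (Diagram.genAll (α := α) m) := by
  induction m with
  | zero => exact .id []
  | succ m ih => exact .tensor .gen ih

theorem IsAutomaton.delAll (m : ℕ) : IsAutomaton (Diagram.delAll (α := α) m) := by
  induction m with
  | zero => exact .id []
  | succ m ih => exact .tensor .del ih

theorem IsAutomaton.inject (m : ℕ) (i : Fin m) : IsAutomaton (Diagram.inject (α := α) m i) := by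
  induction m with
  | zero => exact i.elim0
  | succ m ih =>
    obtain ⟨_ | i, h⟩ := i
    · exact .tensor (.id _) (.genAll m)
    · exact .tensor .gen (ih ⟨i, Nat.lt_of_succ_lt_succ h⟩)

theorem oneWires_eq_mk_genAll (m : ℕ) :
    (black α).oneWires m = Class.mk (Diagram.genAll (α := α) m) := by
  induction m with
  | zero => rfl
  | succ m ih => exact (Class.id_comp _).trans (congrArg (Class.tensor genHom) ih)

theorem counitWires_eq_mk_delAll (m : ℕ) :
    (black α).counitWires m = Class.mk (Diagram.delAll (α := α) m) := by
  induction m with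
  | zero => rfl
  | succ m ih => exact (Class.comp_id _).trans (congrArg (Class.tensor delHom) ih)

theorem inlHom_eq_mk (m : ℕ) :
    inlHom (α := α) m = Class.mk (Diagram.inject (m + 1) ⟨0, m.succ_pos⟩) :=
  (Class.id_comp _).trans (congrArg (Class.tensor (Class.idOfEq rfl)) (oneWires_eq_mk_genAll m))

theorem inrHom_eq_mk (m : ℕ) :
    inrHom (α := α) m = Class.mk (Diagram.gen ⊕ᵈ Diagram.id (rights m)) :=
  Class.id_comp (Class.mk (Diagram.gen ⊕ᵈ Diagram.id (rights m)))

theorem fstHom_eq_mk (n : ℕ) :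
    fstHom (α := α) n = Class.mk (Diagram.project (n + 1) ⟨0, n.succ_pos⟩) :=
  (Class.comp_id _).trans (congrArg (Class.tensor (Class.idOfEq rfl)) (counitWires_eq_mk_delAll n))

theorem sndHom_eq_mk (n : ℕ) :
    sndHom (α := α) n = Class.mk (Diagram.del ⊕ᵈ Diagram.id (rights n)) :=
  Class.comp_id (Class.mk (Diagram.del ⊕ᵈ Diagram.id (rights n)))

/-- The inclusion of a later wire factors through the inclusion of all wires but the first, which
matches `inject` with the induction. -/
theorem mk_inject_succ {m : ℕ} (i : Fin m) :
    Class.mk (Diagram.inject (α := α) (m + 1) ⟨i + 1, Nat.succ_lt_succ i.2⟩) =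
      Class.mk (Diagram.inject m i ⨟ (Diagram.gen ⊕ᵈ Diagram.id (rights m))) := by
  have h (f : Obj.wire (α := α) ⟶ Obj.wires m) :
      (λ_ _).inv ≫ (genHom ⊗ₘ f) = f ≫ (λ_ _).inv ≫ genHom ▷ Obj.wires m := by
    simp [MonoidalCategory.tensorHom_def']
  have k := h (Class.mk (Diagram.inject m i))
  exact ((Class.id_comp _).symm.trans k).trans (congrArg (Class.comp _) (Class.id_comp _))

theorem mk_project_succ {n : ℕ} (j : Fin n) :
    Class.mk (Diagram.project (α := α) (n + 1) ⟨j + 1, Nat.succ_lt_succ j.2⟩) =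
      Class.mk ((Diagram.del ⊕ᵈ Diagram.id (rights n)) ⨟ Diagram.project n j) := by
  have h (f : Obj.wires (α := α) n ⟶ Obj.wire) :
      (delHom ⊗ₘ f) ≫ (λ_ _).hom = (delHom ▷ Obj.wires n ≫ (λ_ _).hom) ≫ f := by
    simp [MonoidalCategory.tensorHom_def]
  have k := h (Class.mk (Diagram.project n j))
  exact ((Class.comp_id _).symm.trans k).trans
    (congrArg (fun g => Class.comp g _) (Class.comp_id _))

theorem equal_of_inject {m n : ℕ} {d e : Diagram α (rights m) (rights n)} (hd : IsAutomaton d)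
    (he : IsAutomaton e) (h : ∀ i, Equal (Diagram.inject m i ⨟ d) (Diagram.inject m i ⨟ e)) :
    Equal d e := by
  rw [← Class.mk_eq_mk]
  induction m with
  | zero => exact hd.isLinear.eq_of_domain_zero he.isLinear
  | succ m ih =>
    have hi : IsAutomaton (Diagram.gen (α := α) ⊕ᵈ Diagram.id (rights m)) := .tensor .gen (.id _)
    refine hd.isLinear.eq_of_inclusions he.isLinear ?_ ?_
    · rw [inlHom_eq_mk]
      exact Class.mk_eq_mk.2 (h _)
    · rw [inrHom_eq_mk]
      -- The restriction to the last `m` wires is again an automaton-diagram, and its `i`-th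
      -- restriction is the `(i + 1)`-th restriction of the original one.
      refine ih (.comp hi hd) (.comp hi he) fun i => ?_
      have k (f : Diagram α (rights (m + 1)) (rights n)) :
          Class.mk (Diagram.inject m i ⨟ ((Diagram.gen ⊕ᵈ Diagram.id (rights m) :) ⨟ f)) =
            Class.mk (Diagram.inject (m + 1) ⟨i + 1, Nat.succ_lt_succ i.2⟩ ⨟ f) :=
        (Class.assoc (Class.mk _) (Class.mk _) (Class.mk _)).symm.trans
          (congrArg (fun g => Class.comp g (Class.mk f)) (mk_inject_succ i).symm)
      rw [← Class.mk_eq_mk]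
      exact (k d).trans ((Class.mk_eq_mk.2 (h _)).trans (k e).symm)

theorem equal_of_project {m n : ℕ} {d e : Diagram α (rights m) (rights n)} (hd : IsAutomaton d)
    (he : IsAutomaton e) (h : ∀ j, Equal (d ⨟ Diagram.project n j) (e ⨟ Diagram.project n j)) :
    Equal d e := by
  rw [← Class.mk_eq_mk]
  induction n with
  | zero => exact hd.isLinear.eq_of_codomain_zero he.isLinear
  | succ n ih =>
    have hp : IsAutomaton (Diagram.del (α := α) ⊕ᵈ Diagram.id (rights n)) := .tensor .del (.id _)
    refine hd.isLinear.eq_of_projections he.isLinear ?_ ?_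
    · rw [fstHom_eq_mk]
      exact Class.mk_eq_mk.2 (h _)
    · rw [sndHom_eq_mk]
      refine ih (.comp hd hp) (.comp he hp) fun j => ?_
      have k (f : Diagram α (rights m) (rights (n + 1))) :
          Class.mk ((f ⨟ (Diagram.del ⊕ᵈ Diagram.id (rights n) :)) ⨟ Diagram.project n j) =
            Class.mk (f ⨟ Diagram.project (n + 1) ⟨j + 1, Nat.succ_lt_succ j.2⟩) :=
        (Class.assoc (Class.mk _) (Class.mk _) (Class.mk _)).trans
          (congrArg (Class.comp (Class.mk f)) (mk_project_succ j).symm)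
      rw [← Class.mk_eq_mk]
      exact (k d).trans ((Class.mk_eq_mk.2 (h _)).trans (k e).symm)

end KDA

theorem mainTheorem5 {α : Type*} {m n : ℕ}
    (d e : KDA.Diagram α (KDA.rights m) (KDA.rights n))
    (hd : KDA.IsAutomaton d) (he : KDA.IsAutomaton e) :
    KDA.Equal d e ↔
      ∀ (i : Fin m) (j : Fin n), KDA.Equal (d.coeff i j) (e.coeff i j) := by
  refine ⟨fun h i j => ?_, fun h => KDA.equal_of_inject hd he fun i => ?_⟩
  · exact KDA.equal_comp (KDA.equal_comp ⟨.refl _, .refl _⟩ h) ⟨.refl _, .refl _⟩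
  · exact KDA.equal_of_project (m := 1) (.comp (.inject m i) hd) (.comp (.inject m i) he) (h i)
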